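/- All graphs are finite, simple and undirected. Let $G$ be a graph with a total order $\le$ on $V(G)$ and let $r\ge 1$. An $r$-admissible path from $v$ to $x$ is a simple path of length at most $r$ such that $x<v$ and every internal vertex $w$ satisfies $w>v$. Let $\mathrm{pp}^r_{\le}(v)$ be the maximum number of $r$-admissible paths starting at $v$ that pairwise share no vertex other than $v$. The $r$-admissibility of $G$ is $\mathrm{adm}_r(G)=\min_{\le}\max_{v}\mathrm{pp}^r_{\le}(v)$, where the minimum is over all total orders of $V(G)$. A graph family $\mathcal F$ has universally bounded $r$-admissibility if there is a computable function $f:\mathbb N\to\mathbb N$ such that $\mathrm{adm}_r(G)\le f(r)$ for every $r\ge 1$ and every $G\in\mathcal F$. In the random neighbour oracle model, an algorithm receives the number $n\ge 1$ of vertices, a (rational) proximity parameter $\epsilon>0$, and access to a graph $G=([n],E)$ only through queries: a query is a vertex $v$, and the answer is an independent, uniformly random neighbour of $v$ (or the information that $v$ has no neighbour). A graph $G$ on $n$ vertices is $\epsilon$-far from a property $\mathcal P$ if at least $\epsilon n$ edges must be added to or removed from $G$ to obtain a graph in $\mathcal P$; if this is impossible, then $G$ is $\epsilon$-far from $\mathcal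 P$. A property $\mathcal P$ is testable with one-sided error on $\mathcal F$ if there is a randomized algorithm in this model such that, for all $n\ge 1$, all $\epsilon>0$ and every $G\in\mathcal F$ on vertex set $[n]$: it always halts; its number of queries is at most $q(\epsilon)$, where $q$ may depend on $\mathcal P$ and $\mathcal F$ but not on $n$ or $G$; it accepts with probability $1$ if $G\in\mathcal P$; and it rejects with probability at least $2/3$ if $G$ is $\epsilon$-far from $\mathcal P$. **Theorem.** Every graph family $\mathcal F$ with universally bounded $r$-admissibility is $H$-testable: for every graph $H$, the property of being $H$-free (containing no subgraph, induced or not, isomorphic to $H$) is testable with one-sided error on $\mathcal F$. -/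

import Mathlib

namespace GraphTesting

/-! ### Admissibility -/

section Admissibility

variable {V : Type*}

/-- `P` is an `r`-admissible path from `v` to `x` for the vertex order `L`: a simple path of length
at most `r` with `x < v`, all of whose internal vertices `w` satisfy `v < w`. -/
def IsAdmissiblePath (G : SimpleGraph V) (L : LinearOrder V) (r : ℕ) {v x : V}
    (P : G.Walk v x) : Prop :=
  P.IsPath ∧ P.length ≤ r ∧ L.lt x v ∧ ∀ w ∈ P.support, w ≠ v → w ≠ x → L.lt v w

/-- There is an admissible path packing of size `k` rooted at `v`: a collection of `k`
`r`-admissible paths starting at `v`, no two of which share a vertex other than `v`. -/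
def HasPathPacking (G : SimpleGraph V) (L : LinearOrder V) (r : ℕ) (v : V) (k : ℕ) : Prop :=
  ∃ (x : Fin k → V) (P : ∀ i, G.Walk v (x i)),
    (∀ i, IsAdmissiblePath G L r (P i)) ∧
      ∀ i j, i ≠ j → ∀ w, w ∈ (P i).support → w ∈ (P j).support → w = v

/-- The maximum size of an `r`-admissible path packing rooted at `v`. -/
noncomputable def packingNumber (G : SimpleGraph V) (L : LinearOrder V) (r : ℕ) (v : V) : ℕ∞ :=
  ⨆ (k : ℕ) (_ : HasPathPacking G L r v k), (k : ℕ∞)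

/-- The `r`-admissibility of the graph `G` ordered by `L`. -/
noncomputable def orderedAdm (G : SimpleGraph V) (L : LinearOrder V) (r : ℕ) : ℕ∞ :=
  ⨆ v : V, packingNumber G L r v

/-- The `r`-admissibility of `G`: the minimum over all orders of the vertices. -/
noncomputable def adm (G : SimpleGraph V) (r : ℕ) : ℕ∞ :=
  ⨅ L : LinearOrder V, orderedAdm G L r

end Admissibility

/-! ### Graph families and distance to a property -/

/-- A family (or a property) of finite graphs with vertex sets `{0, …, n - 1}`. -/
abbrev GraphFamily := ∀ n : ℕ, Set (SimpleGraph (Fin n))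

/-- `F` has universally bounded `r`-admissibility. -/
def UniversallyBoundedAdm (F : GraphFamily) : Prop :=
  ∃ f : ℕ → ℕ, Computable f ∧ ∀ r, 1 ≤ r → ∀ n, ∀ G ∈ F n, adm G r ≤ (f r : ℕ∞)

/-- The property of having no subgraph (not necessarily induced) isomorphic to `H`. -/
def HFreeness {k : ℕ} (H : SimpleGraph (Fin k)) : GraphFamily :=
  fun _ => {G | H.Free G}

/-- `G` is `ε`-far from `P`: at least `ε n` edges must be added or removed to obtain a graph
in `P`. -/
def IsFar (P : GraphFamily) (ε : ℝ) {n : ℕ} (G : SimpleGraph (Fin n)) : Prop :=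
  ∀ G' ∈ P n, ε * n ≤ ((symmDiff G.edgeSet G'.edgeSet).ncard : ℝ)

/-! ### Randomized algorithms with a random neighbour oracle -/

/-- One entry of a transcript: `inl (v, a)` records that the oracle was queried at the vertex `v`
and answered `a`; `inr c` records that the number `c` was drawn at random. -/
abbrev Entry := (ℕ × Option ℕ) ⊕ ℕ

/-- What an algorithm does next: `inl b` halts (accepting if `b = true`, rejecting if `b = false`),
`inr (inl v)` queries the oracle at the vertex `v`, and `inr (inr m)` draws a uniformly random
number from `{0, …, m}`. -/
abbrev Action := Bool ⊕ (ℕ ⊕ ℕ)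

/-- The input parameters of an algorithm: the number `n` of vertices and the numerator and
denominator `(a, b)` of the proximity parameter `ε = a / b`. -/
abbrev Params := ℕ × ℕ × ℕ

/-- A randomized oracle algorithm: the next action is a function of the input parameters and the
transcript so far (the most recent entry comes first). -/
abbrev OracleAlgorithm := Params × List Entry → Action

section Oracle

open Classical in
/-- The answer of the random neighbour oracle for `G` to the query `v`: a uniformly random
neighbour of `v`, and `none` if there is none. -/
noncomputable def oracleAnswer {n : ℕ} (G : SimpleGraph (Fin n)) (v : ℕ) : PMF (Option ℕ) :=
  if h : ∃ hv : v < n, (G.neighborFinset ⟨v, hv⟩).Nonempty then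
    (PMF.uniformOfFinset (G.neighborFinset ⟨v, h.1⟩) h.2).map fun u => some (u : ℕ)
  else PMF.pure none

/-- One step of the algorithm `T` on `G`: the distribution of the next transcript. A transcript on
which `T` has halted does not change. -/
noncomputable def step (T : OracleAlgorithm) (x : Params) {n : ℕ} (G : SimpleGraph (Fin n))
    (tr : List Entry) : PMF (List Entry) :=
  match T (x, tr) with
  | Sum.inl _ => PMF.pure tr
  | Sum.inr (Sum.inl v) => (oracleAnswer G v).map fun a => Sum.inl (v, a) :: tr
  | Sum.inr (Sum.inr m) =>
      (PMF.uniformOfFintype (Fin (m + 1))).map fun c => Sum.inr (c : ℕ) :: tr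

/-- The distribution of the transcript after `t` steps. -/
noncomputable def run (T : OracleAlgorithm) (x : Params) {n : ℕ} (G : SimpleGraph (Fin n)) :
    ℕ → PMF (List Entry)
  | 0 => PMF.pure []
  | t + 1 => (run T x G t).bind (step T x G)

/-- The number of oracle queries recorded in a transcript. -/
def queryCount (tr : List Entry) : ℕ := tr.countP Sum.isLeft

/-- `T` halts on `G` within a bounded number of steps, whatever the random outcomes are. -/
def Halts (T : OracleAlgorithm) (x : Params) {n : ℕ} (G : SimpleGraph (Fin n)) : Prop :=
  ∃ t, ∀ tr ∈ (run T x G t).support, ∃ b, T (x, tr) = Sum.inl b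

/-- `T` makes at most `q` oracle queries on `G`, whatever the random outcomes are. -/
def QueriesAtMost (T : OracleAlgorithm) (x : Params) {n : ℕ} (G : SimpleGraph (Fin n))
    (q : ℕ) : Prop :=
  ∀ t, ∀ tr ∈ (run T x G t).support, queryCount tr ≤ q

/-- The probability that `T` halts on `G` with verdict `b`. The probability that this has happened
within `t` steps is nondecreasing in `t`. -/
noncomputable def verdictProb (T : OracleAlgorithm) (x : Params) {n : ℕ}
    (G : SimpleGraph (Fin n)) (b : Bool) : ENNReal :=
  ⨆ t, ((run T x G t).map fun tr => T (x, tr)) (Sum.inl b)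

end Oracle

/-! ### Testability -/

/-- The property `P` is testable with one-sided error on the family `F`: there is a randomized
algorithm with random neighbour oracle access whose number of queries is bounded by a function `q`
of `ε` alone, which accepts every member of `F` in `P` with probability one, and rejects every
member of `F` that is `ε`-far from `P` with probability at least `2 / 3`. -/
def TestableOneSided (P F : GraphFamily) : Prop :=
  ∃ (T : OracleAlgorithm) (q : ℚ → ℕ), Computable T ∧
    ∀ n a b : ℕ, 0 < n → 0 < a → 0 < b → ∀ G ∈ F n,
      Halts T (n, a, b) G ∧
      QueriesAtMost T (n, a, b) G (q ((a : ℚ) / b)) ∧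
      (G ∈ P n → verdictProb T (n, a, b) G true = 1) ∧
      (IsFar P ((a : ℝ) / b) G → 2 / 3 ≤ verdictProb T (n, a, b) G false)

/-- The family `F` is `H`-testable: for every graph `H`, being `H`-free is testable with one-sided
error on `F`. -/
def HTestable (F : GraphFamily) : Prop :=
  ∀ (k : ℕ) (H : SimpleGraph (Fin k)), TestableOneSided (HFreeness H) F

end GraphTesting

/-!
Order the vertices so that only boundedly many of them are weakly reachable from any given one. If
`G` is far from being `H`-free, it contains linearly many edge-disjoint copies of `H`, a constant
fraction of which agrees with a suitable colouring of the vertices by `V(H)`. A search for a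
coloured copy proceeds along the order: once `φ h` is known, the parts of the copy above it are
attached to the rest only through vertices weakly reachable from `φ h`. So, up to boundedly many
choices of these, a random neighbour of `φ h` serves as well as the true one provided that it lies
in a set of neighbours from which the missing part can be found. If such a set is sparse among the
neighbours, the edges into it may be deleted; over all sets this deletes fewer edges than there are
disjoint copies. A surviving copy guarantees that every guess of the search succeeds with
probability bounded below, and the number of guesses depends on `H` only. Repeating a
random exploration a constant number of times hence reveals a copy with probability at least
`2 / 3`, while a revealed copy always certifies that `G` is not `H`-free.
-/

namespace GraphTesting

/-! ### Weak reachability -/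

section WeakReachability

variable {V : Type*}

lemma HasPathPacking.succ {G : SimpleGraph V} {L : LinearOrder V} {r k : ℕ} {v y : V}
    {x : Fin k → V} {P : ∀ i, G.Walk v (x i)} (hP : ∀ i, IsAdmissiblePath G L r (P i))
    (hdisj : ∀ i j, i ≠ j → ∀ w, w ∈ (P i).support → w ∈ (P j).support → w = v)
    {Q : G.Walk v y} (hQ : IsAdmissiblePath G L r Q)
    (hQP : ∀ i, ∀ w ∈ Q.support, w ∈ (P i).support → w = v) :
    HasPathPacking G L r v (k + 1) := by
  refine ⟨Fin.cons y x, Fin.cons (α := fun i => G.Walk v (Fin.cons (α := fun _ => V) y x i)) Q P,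
    Fin.cases hQ hP, Fin.cases (Fin.cases (fun h => absurd rfl h) fun j _ => hQP j)
      fun i => Fin.cases (fun _ w hw hw' => hQP i w hw' hw) fun j hij => hdisj i j ?_⟩
  exact fun h => hij (congrArg Fin.succ h)

variable [LinearOrder V] {G : SimpleGraph V} {r : ℕ}

lemma exists_finset_meeting_admissible_paths {p : ℕ} {v : V}
    (hp : ∀ k, HasPathPacking G ‹_› r v k → k ≤ p) :
    ∃ Z : Finset V, Z.card ≤ p * r ∧ ∀ (y : V) (Q : G.Walk v y), IsAdmissiblePath G ‹_› r Q →
      ∃ z ∈ Q.support, z ≠ v ∧ z ∈ Z := by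
  classical
  have h0 : HasPathPacking G ‹_› r v 0 := ⟨nofun, nofun, nofun, nofun⟩
  obtain ⟨k, ⟨x, P, hP, hdisj⟩, hmax⟩ : ∃ k, HasPathPacking G ‹_› r v k ∧
      ¬ HasPathPacking G ‹_› r v (k + 1) :=
    ⟨_, Nat.findGreatest_spec p.zero_le h0, fun h =>
      (Nat.le_findGreatest (hp _ h) h).not_gt (Nat.lt_succ_self _)⟩
  refine ⟨Finset.univ.biUnion fun i => (P i).support.toFinset.erase v, ?_, fun y Q hQ => ?_⟩
  · calc _ ≤ (Finset.univ : Finset (Fin k)).card * r := by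
          refine Finset.card_biUnion_le_card_mul _ _ _ fun i _ => ?_
          rw [Finset.card_erase_of_mem (by simp), Nat.sub_le_iff_le_add]
          exact (P i).support.toFinset_card_le.trans (by simpa using (hP i).2.1)
      _ ≤ p * r := by simpa using Nat.mul_le_mul_right r (hp k ⟨x, P, hP, hdisj⟩)
  · by_contra! hcon
    refine hmax (.succ hP hdisj hQ fun i w hw hwi => ?_)
    by_contra hne
    exact hcon w hw hne (Finset.mem_biUnion.2 ⟨i, Finset.mem_univ i, by simp [hne, hwi]⟩)

lemma exists_isAdmissiblePath_support_subset {v x : V} {P : G.Walk v x} (hP : P.IsPath)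
    (hlen : P.length ≤ r) (hx : x < v) :
    ∃ (y : V) (Q : G.Walk v y), IsAdmissiblePath G ‹_› r Q ∧ Q.support ⊆ P.support := by
  have hex : ∃ i, P.getVert i < v := ⟨P.length, by simpa using hx⟩
  refine ⟨_, P.take (Nat.find hex), ⟨hP.take _, ?_, Nat.find_spec hex, fun w hw hwv hwx => ?_⟩, ?_⟩
  · exact (P.take_length _).trans_le (inf_le_right.trans hlen)
  · obtain ⟨j, rfl, -⟩ := SimpleGraph.Walk.mem_support_iff_exists_getVert.1 hw
    rw [SimpleGraph.Walk.take_getVert] at hwv hwx ⊢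
    have hj := lt_of_le_of_ne (inf_le_left : Nat.find hex ⊓ j ≤ _) fun h => hwx (by rw [h])
    exact lt_of_le_of_ne (not_lt.1 (Nat.find_min hex hj)) hwv.symm
  · exact SimpleGraph.Walk.IsSubwalk.support_subset (P.isSubwalk_take _)

/-- The set of vertices weakly `r`-reachable from `v`: those that are the least vertex of some path
of length at most `r` starting at `v`. -/
noncomputable def weakReachSet [Fintype V] (G : SimpleGraph V) (r : ℕ) (v : V) : Finset V :=
  open scoped Classical in
  {x | ∃ P : G.Walk v x, P.IsPath ∧ P.length ≤ r ∧ ∀ y ∈ P.support, x ≤ y}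

lemma mem_weakReachSet [Fintype V] {v x : V} : x ∈ weakReachSet G r v ↔
    ∃ P : G.Walk v x, P.IsPath ∧ P.length ≤ r ∧ ∀ y ∈ P.support, x ≤ y := by
  simp [weakReachSet]

/-- The vertices reached from `v` in at most `i` jumps, where a jump leads from `u` into `Z u`. -/
def jumpSet (Z : V → Finset V) : ℕ → V → Finset V
  | 0, v => {v}
  | i + 1, v => insert v ((Z v).biUnion (jumpSet Z i))

lemma card_jumpSet_le {Z : V → Finset V} {s : ℕ} (hZ : ∀ v, (Z v).card ≤ s) (i : ℕ) (v : V) :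
    (jumpSet Z i v).card ≤ (s + 1) ^ i := by
  induction i generalizing v with
  | zero => simp [jumpSet]
  | succ i ih =>
    calc _ ≤ ((Z v).biUnion (jumpSet Z i)).card + 1 := Finset.card_insert_le _ _
      _ ≤ (Z v).card * (s + 1) ^ i + 1 := by
        gcongr; exact Finset.card_biUnion_le_card_mul _ _ _ fun u _ => ih u
      _ ≤ s * (s + 1) ^ i + (s + 1) ^ i := by gcongr; exacts [hZ v, Nat.one_le_pow' i s]
      _ = (s + 1) ^ (i + 1) := by ring

lemma mem_jumpSet_of_isPath {Z : V → Finset V}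
    (hZ : ∀ (v y : V) (Q : G.Walk v y), IsAdmissiblePath G ‹_› r Q →
      ∃ z ∈ Q.support, z ≠ v ∧ z ∈ Z v) {x : V} {i : ℕ} (hi : i ≤ r) {v : V}
    {P : G.Walk v x} (hP : P.IsPath) (hlen : P.length ≤ i)
    (hx : ∀ y ∈ P.support, x ≤ y) : x ∈ jumpSet Z i v := by
  induction i generalizing v with
  | zero => simp [jumpSet, SimpleGraph.Walk.eq_of_length_eq_zero (Nat.le_zero.1 hlen)]
  | succ i ih =>
    rw [jumpSet, Finset.mem_insert, Finset.mem_biUnion]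
    obtain hxv | hxv := (hx v P.start_mem_support).eq_or_lt
    · exact .inl hxv
    obtain ⟨y, Q, hQ, hQP⟩ := exists_isAdmissiblePath_support_subset hP (hlen.trans hi) hxv
    obtain ⟨z, hzQ, hzv, hzZ⟩ := hZ v y Q hQ
    have hlt := SimpleGraph.Walk.length_dropUntil_lt_length (hQP hzQ) hzv
    exact .inr ⟨z, hzZ, ih (by omega) (hP.dropUntil _) (by omega)
      fun w hw => hx w (P.support_dropUntil_subset_support _ hw)⟩

lemma card_weakReachSet_le [Fintype V] {p : ℕ} (hp : ∀ v k, HasPathPacking G ‹_› r v k → k ≤ p)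
    (v : V) : (weakReachSet G r v).card ≤ (p * r + 1) ^ r := by
  choose Z hZcard hZ using fun v => exists_finset_meeting_admissible_paths (hp v)
  refine (Finset.card_le_card fun x hx => ?_).trans (card_jumpSet_le hZcard r v)
  obtain ⟨P, hP, hlen, hmin⟩ := mem_weakReachSet.1 hx
  exact mem_jumpSet_of_isPath hZ le_rfl hP hlen hmin

lemma self_mem_weakReachSet [Fintype V] (v : V) : v ∈ weakReachSet G r v :=
  mem_weakReachSet.2 ⟨.nil, by simp, by simp, by simp⟩

end WeakReachability

theorem exists_linearOrder_card_weakReachSet_le {V : Type*} [Fintype V] {G : SimpleGraph V}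
    {r p : ℕ} (h : adm G r ≤ p) :
    ∃ _ : LinearOrder V, ∀ v, (weakReachSet G r v).card ≤ (p * r + 1) ^ r := by
  obtain ⟨L, hL⟩ := iInf_lt_iff.1 (h.trans_lt (Nat.cast_lt.2 p.lt_succ_self))
  refine ⟨L, card_weakReachSet_le fun v k hk => Nat.lt_succ_iff.1 (Nat.cast_lt (α := ℕ∞).1 ?_)⟩
  calc (k : ℕ∞) ≤ packingNumber G L r v := le_iSup₂ (f := fun (k : ℕ) _ => (k : ℕ∞)) k hk
    _ ≤ orderedAdm G L r := le_iSup (packingNumber G L r) v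
    _ < ((p + 1 : ℕ) : ℕ∞) := hL

/-! ### Exploration by lucky guesses -/

section Exploration

variable {V : Type*} [Fintype V] {G : SimpleGraph V} {κ : ℕ}

open scoped Classical in
/-- `CanReach G κ goal j s`: starting from the known subgraph `s`, the goal can be reached with at
most `j` lucky guesses. A guess reveals either a uniformly random vertex or the edge to a uniformly
random neighbour of a known vertex; it is lucky when it hits a chosen set of density at least
`1 / κ`, and after a lucky guess the goal must remain reachable whatever was hit. -/
inductive CanReach (G : SimpleGraph V) (κ : ℕ) (goal : G.Subgraph → Prop) : ℕ → G.Subgraph → Prop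
  | done {j : ℕ} {s : G.Subgraph} : goal s → CanReach G κ goal j s
  | vertex {j : ℕ} {s : G.Subgraph} (S : Finset V) : Fintype.card V ≤ κ * S.card →
      (∀ u ∈ S, CanReach G κ goal j (s ⊔ G.singletonSubgraph u)) → CanReach G κ goal (j + 1) s
  | neighbor {j : ℕ} {s : G.Subgraph} {v : V} (S : Finset V) : v ∈ s.verts →
      S ⊆ G.neighborFinset v → S.Nonempty → G.degree v ≤ κ * S.card →
      (∀ u (h : G.Adj v u), u ∈ S → CanReach G κ goal j (s ⊔ G.subgraphOfAdj h)) →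
      CanReach G κ goal (j + 1) s

namespace CanReach

variable {goal goal' : G.Subgraph → Prop} {j j' : ℕ} {s s' : G.Subgraph}

lemma mono_steps (h : CanReach G κ goal j s) (hj : j ≤ j') : CanReach G κ goal j' s := by
  induction h generalizing j' with
  | done hg => exact .done hg
  | vertex S hS _ ih =>
    obtain ⟨i, rfl⟩ := Nat.exists_eq_succ_of_ne_zero (Nat.ne_zero_of_lt hj)
    exact .vertex S hS fun u hu => ih u hu (Nat.le_of_succ_le_succ hj)
  | neighbor S hv hS hne hcard _ ih =>
    obtain ⟨i, rfl⟩ := Nat.exists_eq_succ_of_ne_zero (Nat.ne_zero_of_lt hj)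
    exact .neighbor S hv hS hne hcard fun u hvu hu => ih u hvu hu (Nat.le_of_succ_le_succ hj)

lemma mono_state (hg : Monotone goal) (h : CanReach G κ goal j s) (hs : s ≤ s') :
    CanReach G κ goal j s' := by
  induction h generalizing s' with
  | done h => exact .done (hg hs h)
  | vertex S hS _ ih => exact .vertex S hS fun u hu => ih u hu (sup_le_sup_right hs _)
  | neighbor S hv hS hne hcard _ ih =>
    exact .neighbor S (hs.1 hv) hS hne hcard fun u hvu hu => ih u hvu hu (sup_le_sup_right hs _)

lemma bind (h : CanReach G κ goal j s)
    (h' : ∀ s', s ≤ s' → goal s' → CanReach G κ goal' j' s') :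
    CanReach G κ goal' (j + j') s := by
  induction h with
  | done hg => exact (h' _ le_rfl hg).mono_steps (Nat.le_add_left _ _)
  | vertex S hS _ ih =>
    rw [Nat.succ_add]
    exact .vertex S hS fun u hu => ih u hu fun s' hs' => h' s' (le_sup_left.trans hs')
  | neighbor S hv hS hne hcard _ ih =>
    rw [Nat.succ_add]
    exact .neighbor S hv hS hne hcard fun u hvu hu =>
      ih u hvu hu fun s' hs' => h' s' (le_sup_left.trans hs')

lemma mono_goal (h : CanReach G κ goal j s) (h' : ∀ s', s ≤ s' → goal s' → goal' s') :
    CanReach G κ goal' j s :=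
  h.bind (j' := 0) fun s' hs hg => .done (h' s' hs hg)

lemma forall_mem_finset {ι : Type*} {goals : ι → G.Subgraph → Prop} {t : Finset ι}
    (hmono : ∀ i ∈ t, Monotone (goals i))
    (h : ∀ i ∈ t, ∀ s', s ≤ s' → CanReach G κ (goals i) j s') :
    CanReach G κ (fun s' => ∀ i ∈ t, goals i s') (t.card * j) s := by
  classical
  induction t using Finset.induction_on with
  | empty => exact .done (by simp)
  | insert a t ha ih =>
    simp only [Finset.forall_mem_insert] at hmono h ⊢
    rw [Finset.card_insert_of_notMem ha, Nat.succ_mul]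
    exact (ih hmono.2 h.2).bind fun s' hs' hall => (h.1 s' hs').mono_goal fun s'' hs'' hga =>
      ⟨hga, fun i hi => hmono.2 i hi hs'' (hall i hi)⟩

end CanReach

end Exploration

/-! ### Components inside a set of vertices -/

section Components

variable {K : Type*} [Fintype K] {H : SimpleGraph K} {U U' : Set K} {g x y : K}

open scoped Classical in
/-- The component of `g` in the subgraph of `H` induced by `U`: the vertices joined to `g` by a walk
inside `U`. It is empty when `g ∉ U`. -/
noncomputable def compIn (H : SimpleGraph K) (U : Set K) (g : K) : Finset K :=
  {x | ∃ p : H.Walk g x, ∀ y ∈ p.support, y ∈ U}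

lemma mem_compIn : x ∈ compIn H U g ↔ ∃ p : H.Walk g x, ∀ y ∈ p.support, y ∈ U := by
  simp [compIn]

lemma self_mem_compIn (hg : g ∈ U) : g ∈ compIn H U g :=
  mem_compIn.2 ⟨.nil, by simpa using hg⟩

lemma mem_of_mem_compIn (hx : x ∈ compIn H U g) : x ∈ U := by
  obtain ⟨p, hp⟩ := mem_compIn.1 hx
  exact hp x p.end_mem_support

lemma compIn_subset_of_mem (hU : U' ⊆ U) (hx : x ∈ compIn H U g) :
    compIn H U' x ⊆ compIn H U g := by
  intro y hy
  obtain ⟨p, hp⟩ := mem_compIn.1 hx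
  obtain ⟨q, hq⟩ := mem_compIn.1 hy
  refine mem_compIn.2 ⟨p.append q, fun z hz => ?_⟩
  exact ((SimpleGraph.Walk.mem_support_append_iff _ _).1 hz).elim (hp z) fun hz => hU (hq z hz)

lemma mem_compIn_symm (hx : x ∈ compIn H U g) : g ∈ compIn H U x := by
  obtain ⟨p, hp⟩ := mem_compIn.1 hx
  exact mem_compIn.2 ⟨p.reverse, fun z hz => hp z (by simpa using hz)⟩

lemma compIn_eq_of_mem (hx : x ∈ compIn H U g) : compIn H U x = compIn H U g :=
  (compIn_subset_of_mem le_rfl hx).antisymm (compIn_subset_of_mem le_rfl (mem_compIn_symm hx))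

lemma adj_mem_compIn (hx : x ∈ compIn H U g) (hxy : H.Adj x y) (hy : y ∈ U) :
    y ∈ compIn H U g := by
  obtain ⟨p, hp⟩ := mem_compIn.1 hx
  refine mem_compIn.2 ⟨p.concat hxy, fun z hz => ?_⟩
  rw [SimpleGraph.Walk.support_concat, List.mem_append, List.mem_singleton] at hz
  exact hz.elim (hp z) fun h => h ▸ hy

lemma exists_boundary_compIn (hx : x ∈ compIn H U g) {D : Set K} (hg : g ∈ D) (hxD : x ∉ D) :
    ∃ a ∈ D, ∃ b ∉ D, b ∈ compIn H U g ∧ H.Adj a b := by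
  classical
  obtain ⟨p, hp⟩ := mem_compIn.1 hx
  obtain ⟨d, hd, h1, h2⟩ := p.exists_boundary_dart D hg hxD
  have hd' := p.dart_snd_mem_support_of_mem_darts hd
  exact ⟨d.fst, h1, d.snd, h2, mem_compIn.2 ⟨p.takeUntil _ hd', fun z hz =>
    hp z (p.support_takeUntil_subset_support _ hz)⟩, d.adj⟩

variable {V : Type*} [LinearOrder V] {φ : K → V} {h : K}

lemma exists_adj_mem_compIn_Ioi (hφ : Function.Injective φ)
    (hx : x ∈ compIn H (φ ⁻¹' Set.Ici (φ h)) h) (hxh : x ≠ h) :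
    ∃ g, H.Adj h g ∧ φ h < φ g ∧ x ∈ compIn H (φ ⁻¹' Set.Ioi (φ h)) g := by
  classical
  obtain ⟨p, hp⟩ := mem_compIn.1 hx
  have hge : ∀ y ∈ p.bypass.support, φ h ≤ φ y := fun y hy =>
    hp y (p.support_bypass_subset_support hy)
  have hpath := p.bypass_isPath
  cases hq : p.bypass with
  | nil => exact absurd rfl hxh
  | @cons _ g _ hadj q =>
    rw [hq] at hge hpath
    rw [SimpleGraph.Walk.cons_isPath_iff] at hpath
    have hgt : ∀ y ∈ q.support, φ h < φ y := fun y hy =>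
      (hge y (by simp [hy])).lt_of_ne fun he => hpath.2 (hφ he ▸ hy)
    exact ⟨g, hadj, hgt g q.start_mem_support, mem_compIn.2 ⟨q, hgt⟩⟩

lemma notMem_compIn_Ioi : h ∉ compIn H (φ ⁻¹' Set.Ioi (φ h)) g :=
  fun hh => lt_irrefl (φ h) (Set.mem_preimage.1 (mem_of_mem_compIn hh))

lemma card_compIn_Ioi_lt (hg : H.Adj h g) (hlt : φ h < φ g) :
    (compIn H (φ ⁻¹' Set.Ioi (φ h)) g).card < (compIn H (φ ⁻¹' Set.Ici (φ h)) h).card := by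
  have hself : h ∈ compIn H (φ ⁻¹' Set.Ici (φ h)) h := self_mem_compIn (le_refl (φ h))
  refine Finset.card_lt_card ((Finset.ssubset_iff_of_subset (compIn_subset_of_mem
    (fun _ hy => le_of_lt hy) (adj_mem_compIn hself hg hlt.le))).2 ⟨h, hself, notMem_compIn_Ioi⟩)

lemma exists_adj_lt_of_compIn_ne (hU : ∀ x ∈ U, ∀ y, φ x ≤ φ y → y ∈ U) (hh : h ∈ U)
    (hne : compIn H (φ ⁻¹' Set.Ici (φ h)) h ≠ compIn H U h) :
    ∃ x ∈ compIn H (φ ⁻¹' Set.Ici (φ h)) h, ∃ y ∈ compIn H U h,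
      y ∉ compIn H (φ ⁻¹' Set.Ici (φ h)) h ∧ H.Adj x y ∧ φ y < φ h := by
  have hsub : compIn H (φ ⁻¹' Set.Ici (φ h)) h ⊆ compIn H U h :=
    compIn_subset_of_mem (hU h hh) (self_mem_compIn hh)
  obtain ⟨b, hb, hbn⟩ := Finset.exists_of_ssubset (hsub.ssubset_of_ne hne)
  obtain ⟨x, hx, y, hy, hyU, hxy⟩ := exists_boundary_compIn hb
    (D := compIn H (φ ⁻¹' Set.Ici (φ h)) h) (Finset.mem_coe.2 (self_mem_compIn (le_refl (φ h))))
    (mt Finset.mem_coe.1 hbn)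
  rw [Finset.mem_coe] at hx hy
  exact ⟨x, hx, y, hyU, hy, hxy, not_le.1 fun hle => hy (adj_mem_compIn hx hxy hle)⟩

end Components

/-! ### Finding coloured copies -/

section PartialCopies

variable {V K : Type*}

/-- The part of a copy of `H` that touches `C` has been found: there is a map `φ`, prescribed to be
`ψ` outside `C`, that sends each vertex of `C` to a vertex of its own colour under `χ` and each edge
of `H` touching `C` to an edge of the known subgraph `s`. -/
def Found {G : SimpleGraph V} (H : SimpleGraph K) (χ : V → K) (C : Finset K) (ψ : K → V)
    (s : G.Subgraph) : Prop :=
  ∃ φ : K → V, (∀ y ∉ C, φ y = ψ y) ∧ (∀ x ∈ C, χ (φ x) = x) ∧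
    ∀ x ∈ C, ∀ y, H.Adj x y → s.Adj (φ x) (φ y)

section Found

variable {G : SimpleGraph V} {H : SimpleGraph K} {χ : V → K} {C : Finset K} {ψ ψ' : K → V}
  {s : G.Subgraph}

lemma monotone_found : Monotone (Found (G := G) H χ C ψ) := by
  rintro s s' hs ⟨φ, hψ, hcol, hadj⟩
  exact ⟨φ, hψ, hcol, fun x hx y hxy => hs.2 (hadj x hx y hxy)⟩

lemma Found.congr (h : Found H χ C ψ s) (hψ : ∀ x ∈ C, ∀ y ∉ C, H.Adj x y → ψ y = ψ' y) :
    Found H χ C ψ' s := by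
  classical
  obtain ⟨φ, hφ, hcol, hadj⟩ := h
  refine ⟨C.piecewise φ ψ', fun y hy => C.piecewise_eq_of_notMem _ _ hy, fun x hx => ?_,
    fun x hx y hxy => ?_⟩
  · rw [C.piecewise_eq_of_mem _ _ hx, hcol x hx]
  · rw [C.piecewise_eq_of_mem _ _ hx]
    by_cases hy : y ∈ C
    · rw [C.piecewise_eq_of_mem _ _ hy]; exact hadj x hx y hxy
    · rw [C.piecewise_eq_of_notMem _ _ hy, ← hψ x hx y hy hxy, ← hφ y hy]; exact hadj x hx y hxy

lemma found_of_forall_part {part : K → Finset K} (hself : ∀ x ∈ C, x ∈ part x)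
    (hsub : ∀ x ∈ C, part x ⊆ C) (hpart : ∀ x ∈ C, ∀ y ∈ C, H.Adj x y → part y = part x)
    (h : ∀ x ∈ C, Found H χ (part x) ψ s) : Found H χ C ψ s := by
  classical
  have : Nonempty (K → V) := ⟨ψ⟩
  have hfound : ∀ D, Found H χ D ψ s → ∃ φ : K → V, (∀ y ∉ D, φ y = ψ y) ∧
    (∀ x ∈ D, χ (φ x) = x) ∧ ∀ x ∈ D, ∀ y, H.Adj x y → s.Adj (φ x) (φ y) := fun _ hD => hD
  choose! f hψ hcol hadj using hfound
  refine ⟨C.piecewise (fun x => f (part x) x) ψ, fun y hy => C.piecewise_eq_of_notMem _ _ hy,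
    fun x hx => ?_, fun x hx y hxy => ?_⟩
  · rw [C.piecewise_eq_of_mem _ _ hx, hcol _ (h x hx) x (hself x hx)]
  · rw [C.piecewise_eq_of_mem _ _ hx]
    by_cases hy : y ∈ C
    · rw [C.piecewise_eq_of_mem _ _ hy, hpart x hx y hy hxy]
      exact hadj _ (h x hx) x (hself x hx) y hxy
    · rw [C.piecewise_eq_of_notMem _ _ hy, ← hψ _ (h x hx) y fun hyx => hy (hsub x hx hyx)]
      exact hadj _ (h x hx) x (hself x hx) y hxy

lemma Found.insert [DecidableEq K] {h : K} (hC : Found H χ C ψ s) (hh : h ∉ C)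
    (hcol : χ (ψ h) = h) (hadj : ∀ g ∉ C, H.Adj h g → s.Adj (ψ h) (ψ g)) :
    Found H χ (insert h C) ψ s := by
  obtain ⟨φ, hψ, hcol', hadj'⟩ := hC
  have hφh := hψ h hh
  refine ⟨φ, fun y hy => hψ y (mt Finset.mem_insert_of_mem hy), ?_, ?_⟩ <;>
    simp only [Finset.forall_mem_insert]
  · exact ⟨hφh ▸ hcol, hcol'⟩
  · refine ⟨fun g hg => ?_, hadj'⟩
    by_cases hgC : g ∈ C
    · exact (hadj' g hgC h hg.symm).symm
    · rw [hφh, hψ g hgC]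
      exact hadj g hgC hg

lemma found_compIn_univ_of_isolated [Fintype K] {g : K} (hcol : χ (ψ g) = g)
    (hg : ∀ y, ¬ H.Adj g y) : Found H χ (compIn H Set.univ g) ψ s := by
  have hsingle : ∀ x ∈ compIn H Set.univ g, x = g := by
    intro x hx
    obtain ⟨p, -⟩ := mem_compIn.1 hx
    cases p with
    | nil => rfl
    | cons h => exact absurd h (hg _)
  exact ⟨ψ, fun _ _ => rfl, fun x hx => hsingle x hx ▸ hcol,
    fun x hx y hxy => absurd (hsingle x hx ▸ hxy) (hg y)⟩

lemma found_compIn_Ici [LinearOrder V] [Fintype K] {φ : K → V} (hφ : Function.Injective φ) {h : K}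
    (hcol : χ (φ h) = h)
    (hup : ∀ g, H.Adj h g → φ h < φ g → Found H χ (compIn H (φ ⁻¹' Set.Ioi (φ h)) g) φ s)
    (hdown : ∀ g, H.Adj h g → φ g < φ h → s.Adj (φ h) (φ g)) :
    Found H χ (compIn H (φ ⁻¹' Set.Ici (φ h)) h) φ s := by
  classical
  set C := compIn H (φ ⁻¹' Set.Ici (φ h)) h
  have hself : h ∈ C := self_mem_compIn (le_refl (φ h))
  have hparts : ∀ x ∈ C.erase h, ∃ g, H.Adj h g ∧ φ h < φ g ∧
      x ∈ compIn H (φ ⁻¹' Set.Ioi (φ h)) g := fun x hx =>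
    exists_adj_mem_compIn_Ioi hφ (Finset.mem_of_mem_erase hx) (Finset.ne_of_mem_erase hx)
  rw [← Finset.insert_erase hself]
  refine Found.insert (found_of_forall_part (part := compIn H (φ ⁻¹' Set.Ioi (φ h)))
    (fun x hx => ?_) (fun x hx y hy => ?_) (fun x hx y hy hxy => ?_) fun x hx => ?_)
    (Finset.notMem_erase h C) hcol fun g hg hhg => ?_
  · obtain ⟨g, -, -, hxg⟩ := hparts x hx
    exact self_mem_compIn (mem_of_mem_compIn hxg)
  · refine Finset.mem_erase.2 ⟨fun hyh => notMem_compIn_Ioi (hyh ▸ hy), ?_⟩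
    exact compIn_subset_of_mem (fun _ h => le_of_lt h) (Finset.mem_of_mem_erase hx) hy
  · obtain ⟨g, -, -, hxg⟩ := hparts x hx
    obtain ⟨g', -, -, hyg'⟩ := hparts y hy
    exact compIn_eq_of_mem (adj_mem_compIn (self_mem_compIn (mem_of_mem_compIn hxg)) hxy
      (mem_of_mem_compIn hyg'))
  · obtain ⟨g, hg, hlt, hxg⟩ := hparts x hx
    rw [compIn_eq_of_mem hxg]
    exact hup g hg hlt
  · refine hdown g hhg (not_le.1 fun hle => hg (Finset.mem_erase.2 ⟨hhg.ne', ?_⟩))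
    exact adj_mem_compIn hself hhg hle

end Found

/-- The number of lucky guesses allowed for finding a part with `s` of the `k` vertices. It
satisfies the recursion of the search: the part is found above at most `s` vertices in turn, and
above each of them at most `k` neighbours cost one guess and a smaller part each. -/
def budget (k : ℕ) : ℕ → ℕ
  | 0 => 0
  | s + 1 => (s + 1) * (k * (1 + budget k s))

lemma budget_of_pos (k : ℕ) {s : ℕ} (hs : 0 < s) :
    budget k s = s * (k * (1 + budget k (s - 1))) := by
  cases s with
  | zero => exact absurd hs (lt_irrefl 0)
  | succ s => rfl

lemma monotone_budget (k : ℕ) : Monotone (budget k) := by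
  refine monotone_nat_of_le_succ fun s => ?_
  induction s with
  | zero => exact Nat.zero_le _
  | succ s ih =>
    change (s + 1) * (k * (1 + budget k s)) ≤ (s + 2) * (k * (1 + budget k (s + 1)))
    gcongr
    omega

variable [Fintype V] [Fintype K]

open scoped Classical in
/-- The neighbours of `v` from which the part of a copy touching `C`, equal to `ψ` outside `C`, can
be found. -/
noncomputable def taskSet (G : SimpleGraph V) (κ : ℕ) (H : SimpleGraph K) (χ : V → K) (v : V)
    (C : Finset K) (ψ : K → V) : Finset V :=
  {u ∈ G.neighborFinset v |
    CanReach G κ (Found H χ C ψ) (budget (Fintype.card K) C.card) (G.singletonSubgraph u)}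

open scoped Classical in
/-- The vertices from which the part of a copy touching `C` can be found, whatever is prescribed
outside `C`. -/
noncomputable def startSet (G : SimpleGraph V) (κ : ℕ) (H : SimpleGraph K) (χ : V → K)
    (C : Finset K) : Finset V :=
  {u | ∀ ψ, CanReach G κ (Found H χ C ψ) (budget (Fintype.card K) C.card) (G.singletonSubgraph u)}

section Sets

variable {G : SimpleGraph V} {κ : ℕ} {H : SimpleGraph K} {χ : V → K} {C : Finset K}

lemma mem_taskSet {v u : V} {ψ : K → V} : u ∈ taskSet G κ H χ v C ψ ↔ G.Adj v u ∧
    CanReach G κ (Found H χ C ψ) (budget (Fintype.card K) C.card) (G.singletonSubgraph u) := by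
  simp [taskSet]

lemma mem_startSet {u : V} : u ∈ startSet G κ H χ C ↔ ∀ ψ, CanReach G κ (Found H χ C ψ)
    (budget (Fintype.card K) C.card) (G.singletonSubgraph u) := by
  simp [startSet]

end Sets

variable [LinearOrder V]

lemma mem_weakReachSet_of_walk {G : SimpleGraph V} {H : SimpleGraph K} {φ : H →g G}
    (hφ : Function.Injective φ) {r : ℕ} (hr : Fintype.card K ≤ r) {h b : K} (p : H.Walk h b)
    (hp : ∀ y ∈ p.support, φ b ≤ φ y) : φ b ∈ weakReachSet G r (φ h) := by
  classical
  refine mem_weakReachSet.2 ⟨p.bypass.map φ,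
    p.bypass_isPath.map hφ, ?_, fun y hy => ?_⟩
  · rw [SimpleGraph.Walk.length_map]
    exact (p.bypass_isPath.length_lt).le.trans hr
  · rw [SimpleGraph.Walk.support_map, List.mem_map] at hy
    obtain ⟨z, hz, rfl⟩ := hy
    exact hp z (p.support_bypass_subset_support hz)

open scoped Classical in
/-- A properly coloured copy `φ` of `H` in the ordered graph `G` that survives the cleaning: each
edge of the copy certifies that the task sets and start sets it could have been deleted for are
dense. -/
structure IsRobustCopy (G : SimpleGraph V) (r κ : ℕ) (H : SimpleGraph K) (χ : V → K)
    (φ : H →g G) : Prop where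
  color : ∀ x, χ (φ x) = x
  degree_le : ∀ h b, H.Adj h b → φ b < φ h → G.degree (φ h) ≤ κ
  degree_le_card_taskSet : ∀ h g, H.Adj h g → ∀ (C : Finset K) (ψ : K → V),
    (∀ i, ψ i ∈ weakReachSet G r (φ h)) → φ g ∈ taskSet G κ H χ (φ h) C ψ →
    G.degree (φ h) ≤ κ * (taskSet G κ H χ (φ h) C ψ).card
  card_le_card_startSet : ∀ h b, H.Adj h b → φ b < φ h → ∀ C : Finset K,
    φ h ∈ startSet G κ H χ C → Fintype.card V ≤ κ * (startSet G κ H χ C).card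

/-- Once `φ h` is known, the part of the copy above `φ h` that is connected to it there can be
found. -/
def CanFindAbove {G : SimpleGraph V} (κ : ℕ) {H : SimpleGraph K} (χ : V → K) (φ : H →g G) (h : K) :
    Prop :=
  ∀ s : G.Subgraph, φ h ∈ s.verts →
    CanReach G κ (Found H χ (compIn H (φ ⁻¹' Set.Ici (φ h)) h) φ)
      (Fintype.card K * (1 + budget (Fintype.card K)
        ((compIn H (φ ⁻¹' Set.Ici (φ h)) h).card - 1))) s

section CanFind

variable {G : SimpleGraph V} {r κ : ℕ} {H : SimpleGraph K} {χ : V → K} {φ : H →g G}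

/- Find the part above `φ g`. If this is not the whole component, it has a neighbour below `φ g`,
which is now known; continue from there. -/
lemma canReach_compIn {U : Set K} (hU : ∀ x ∈ U, ∀ y, φ x ≤ φ y → y ∈ U) {g : K} (hg : g ∈ U)
    (habove : ∀ h ∈ compIn H U g, CanFindAbove κ χ φ h) {s : G.Subgraph} (hs : φ g ∈ s.verts) :
    CanReach G κ (Found H χ (compIn H U g) φ)
      (budget (Fintype.card K) (compIn H U g).card) s := by
  classical
  set D := compIn H U g
  have descend : ∀ t : ℕ, ∀ h ∈ D, (D.filter fun x => φ x ≤ φ h).card ≤ t →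
      ∀ s : G.Subgraph, φ h ∈ s.verts → CanReach G κ (Found H χ D φ)
        (t * (Fintype.card K * (1 + budget (Fintype.card K) (D.card - 1)))) s := by
    intro t
    induction t with
    | zero =>
      intro h hh hcard
      exact absurd hcard (Finset.card_pos.2 ⟨h, by simp [hh]⟩).not_ge
    | succ t ih =>
      intro h hh hcard s hs
      have hhU : h ∈ U := mem_of_mem_compIn hh
      have hsub : compIn H (φ ⁻¹' Set.Ici (φ h)) h ⊆ D := compIn_subset_of_mem (hU h hhU) hh
      have hbudget := monotone_budget (Fintype.card K)
        (Nat.sub_le_sub_right (Finset.card_le_card hsub) 1)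
      rw [Nat.succ_mul, Nat.add_comm]
      refine ((habove h hh s hs).mono_steps (by gcongr)).bind fun s' _ hF => ?_
      by_cases heq : compIn H (φ ⁻¹' Set.Ici (φ h)) h = compIn H U h
      · rw [heq, compIn_eq_of_mem hh] at hF
        exact .done hF
      obtain ⟨x, hx, y, hyU, hyC, hxy, hlt⟩ := exists_adj_lt_of_compIn_ne hU hhU heq
      rw [compIn_eq_of_mem hh] at hyU
      obtain ⟨f, hf, -, hadj⟩ := hF
      have hy : φ y ∈ s'.verts := hf y hyC ▸ s'.edge_vert (hadj x hx y hxy).symm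
      refine ih y hyU (Nat.lt_succ_iff.1 (lt_of_lt_of_le (Finset.card_lt_card ?_) hcard)) s' hy
      refine (Finset.ssubset_iff_of_subset fun z hz => ?_).2 ⟨h, by simp [hh], by simp [hlt]⟩
      rw [Finset.mem_filter] at hz ⊢
      exact ⟨hz.1, hz.2.trans hlt.le⟩
  have hself : g ∈ D := self_mem_compIn hg
  rw [budget_of_pos _ (Finset.card_pos.2 ⟨g, hself⟩)]
  exact descend _ g hself (Finset.card_filter_le _ _) s hs

namespace IsRobustCopy

lemma injective (hφ : IsRobustCopy G r κ H χ φ) : Function.Injective φ :=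
  Function.LeftInverse.injective hφ.color

lemma canReach_of_lt (hφ : IsRobustCopy G r κ H χ φ) (hr : Fintype.card K ≤ r) {h g : K}
    (hg : H.Adj h g) (hlt : φ h < φ g)
    (habove : ∀ h' ∈ compIn H (φ ⁻¹' Set.Ioi (φ h)) g, CanFindAbove κ χ φ h') {s : G.Subgraph}
    (hs : φ h ∈ s.verts) :
    CanReach G κ (Found H χ (compIn H (φ ⁻¹' Set.Ioi (φ h)) g) φ)
      (budget (Fintype.card K) (compIn H (φ ⁻¹' Set.Ioi (φ h)) g).card + 1) s := by
  classical
  set D := compIn H (φ ⁻¹' Set.Ioi (φ h)) g with hD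
  have hboundary : ∀ x ∈ D, ∀ i ∉ D, H.Adj x i → φ i ∈ weakReachSet G r (φ h) := by
    intro x hx i hiD hxi
    obtain ⟨p, hp⟩ := mem_compIn.1 hx
    have hih : φ i ≤ φ h := not_lt.1 fun hlt => hiD (adj_mem_compIn hx hxi hlt)
    refine mem_weakReachSet_of_walk hφ.injective hr ((p.cons hg).concat hxi) fun y hy => ?_
    rw [SimpleGraph.Walk.support_concat, SimpleGraph.Walk.support_cons, List.mem_append,
      List.mem_cons, List.mem_singleton] at hy
    rcases hy with (rfl | hy) | rfl
    exacts [hih, hih.trans (hp y hy).le, le_rfl]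
  obtain ⟨ψ, hψ, hψr⟩ : ∃ ψ : K → V, (∀ x ∈ D, ∀ y ∉ D, H.Adj x y → ψ y = φ y) ∧
      ∀ i, ψ i ∈ weakReachSet G r (φ h) := by
    refine ⟨fun y => if (∃ x ∈ D, H.Adj x y) ∧ y ∉ D then φ y else φ h,
      fun x hx y hy hxy => if_pos ⟨⟨x, hx, hxy⟩, hy⟩, fun i => ?_⟩
    dsimp only
    split_ifs with hi
    · obtain ⟨⟨x, hx, hxi⟩, hiD⟩ := hi
      exact hboundary x hx i hiD hxi
    · exact self_mem_weakReachSet _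
  have hmem : φ g ∈ taskSet G κ H χ (φ h) D ψ := by
    refine mem_taskSet.2 ⟨φ.map_adj hg, ?_⟩
    refine (canReach_compIn (fun x hx y hxy => lt_of_lt_of_le hx hxy) hlt habove
      (Set.mem_singleton _)).mono_goal fun s' _ hF => ?_
    exact hF.congr fun x hx y hy hxy => (hψ x hx y hy hxy).symm
  refine .neighbor _ hs (Finset.filter_subset _ _) ⟨φ g, hmem⟩
    (hφ.degree_le_card_taskSet h g hg D ψ hψr hmem) fun u hu hmemu => ?_
  refine ((mem_taskSet.1 hmemu).2.mono_state monotone_found ?_).mono_goal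
    fun s' _ hF => hF.congr hψ
  exact SimpleGraph.singletonSubgraph_le_iff .. |>.2 (.inr (by simp))

lemma canReach_of_gt (hφ : IsRobustCopy G r κ H χ φ) {h g : K} (hg : H.Adj h g)
    (hlt : φ g < φ h) {s : G.Subgraph} (hs : φ h ∈ s.verts) :
    CanReach G κ (fun s => s.Adj (φ h) (φ g)) 1 s := by
  classical
  refine .neighbor {φ g} hs (by simpa using φ.map_adj hg) (Finset.singleton_nonempty _)
    (by simpa using hφ.degree_le h g hg hlt) fun u hu hmem => .done ?_
  rw [← Finset.mem_singleton.1 hmem]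
  exact .inr (by simp)

lemma canFindAbove (hφ : IsRobustCopy G r κ H χ φ) (hr : Fintype.card K ≤ r) (h : K) :
    CanFindAbove κ χ φ h := by
  classical
  induction hN : (compIn H (φ ⁻¹' Set.Ici (φ h)) h).card using Nat.strong_induction_on
    generalizing h with
  | _ N ih =>
    subst hN
    intro s hs
    have hneighbor : ∀ g ∈ H.neighborFinset h, ∀ s', s ≤ s' → CanReach G κ
        (fun s => (φ h < φ g → Found H χ (compIn H (φ ⁻¹' Set.Ioi (φ h)) g) φ s) ∧
          (φ g < φ h → s.Adj (φ h) (φ g)))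
        (1 + budget (Fintype.card K) ((compIn H (φ ⁻¹' Set.Ici (φ h)) h).card - 1)) s' := by
      intro g hg s' hs'
      rw [SimpleGraph.mem_neighborFinset] at hg
      rcases (hφ.injective.ne hg.ne).lt_or_gt with hlt | hlt
      · have hcard := card_compIn_Ioi_lt hg hlt
        have hbudget := monotone_budget (Fintype.card K) (Nat.le_sub_one_of_lt hcard)
        refine ((hφ.canReach_of_lt hr hg hlt (fun h' hh' => ih _ ?_ h' rfl)
          (hs'.1 hs)).mono_goal fun s'' _ hF => ⟨fun _ => hF, fun hgt => absurd hlt hgt.asymm⟩)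
          |>.mono_steps (by omega)
        refine (Finset.card_le_card (compIn_subset_of_mem (fun y hy => ?_) hh')).trans_lt hcard
        exact lt_of_lt_of_le (mem_of_mem_compIn hh' : h' ∈ φ ⁻¹' Set.Ioi (φ h)) hy
      · exact ((hφ.canReach_of_gt hg hlt (hs'.1 hs)).mono_goal
          fun s'' _ hF => ⟨fun hgt => absurd hlt hgt.asymm, fun _ => hF⟩).mono_steps (by omega)
    refine (CanReach.forall_mem_finset (fun g _ s₁ s₂ hle hgoal =>
      ⟨fun hlt => monotone_found hle (hgoal.1 hlt), fun hlt => hle.2 (hgoal.2 hlt)⟩) hneighbor)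
      |>.mono_steps (Nat.mul_le_mul_right _ (Finset.card_le_univ _)) |>.mono_goal
      fun s' _ hgoal => found_compIn_Ici hφ.injective (hφ.color h)
        (fun g hg => (hgoal g ((H.mem_neighborFinset h g).2 hg)).1)
        (fun g hg => (hgoal g ((H.mem_neighborFinset h g).2 hg)).2)

lemma canReach_component (hφ : IsRobustCopy G r κ H χ φ) (hr : Fintype.card K ≤ r) (x : K)
    (s : G.Subgraph) : CanReach G κ (Found H χ (compIn H Set.univ x) φ)
      (budget (Fintype.card K) (Fintype.card K) + 1) s := by
  obtain ⟨g, hg, hmax⟩ := Finset.exists_max_image (compIn H Set.univ x) φ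
    ⟨x, self_mem_compIn (Set.mem_univ x)⟩
  rw [← compIn_eq_of_mem hg] at hmax ⊢
  by_cases hb : ∃ b, H.Adj g b
  · obtain ⟨b, hgb⟩ := hb
    have hlt : φ b < φ g := (hmax b (adj_mem_compIn (self_mem_compIn (Set.mem_univ g)) hgb
      (Set.mem_univ b))).lt_of_ne (hφ.injective.ne hgb.ne')
    have hmem : φ g ∈ startSet G κ H χ (compIn H Set.univ g) := by
      refine mem_startSet.2 fun ψ => (canReach_compIn (fun _ _ _ _ => Set.mem_univ _)
        (Set.mem_univ g) (fun h _ => hφ.canFindAbove hr h) (Set.mem_singleton _)).mono_goal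
          fun s' _ hF => hF.congr fun a ha c hc hac => ?_
      exact absurd (adj_mem_compIn ha hac (Set.mem_univ c)) hc
    refine .vertex _ (hφ.card_le_card_startSet g b hgb hlt _ hmem) fun u hu => ?_
    exact ((mem_startSet.1 hu φ).mono_steps (monotone_budget _ (Finset.card_le_univ _)))
      |>.mono_state monotone_found le_sup_right
  · exact .done (found_compIn_univ_of_isolated (hφ.color g) (not_exists.1 hb))

theorem canReach_isContained (hφ : IsRobustCopy G r κ H χ φ) (hr : Fintype.card K ≤ r) :
    CanReach G κ (fun s => H.IsContained s.spanningCoe)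
      (Fintype.card K * (budget (Fintype.card K) (Fintype.card K) + 1)) ⊥ := by
  refine (CanReach.forall_mem_finset (t := Finset.univ)
    (fun x _ => monotone_found) fun x _ s _ => hφ.canReach_component hr x s).mono_goal
    fun s _ hall => ?_
  obtain ⟨f, -, hcol, hadj⟩ : Found H χ Finset.univ φ s :=
    found_of_forall_part (part := compIn H Set.univ) (fun x _ => self_mem_compIn (Set.mem_univ x))
      (fun _ _ => Finset.subset_univ _) (fun x _ y _ hxy => compIn_eq_of_mem
        (adj_mem_compIn (self_mem_compIn (Set.mem_univ x)) hxy (Set.mem_univ y))) hall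
  exact ⟨⟨⟨f, fun hxy => hadj _ (Finset.mem_univ _) _ hxy⟩,
    Function.LeftInverse.injective fun x => hcol x (Finset.mem_univ x)⟩⟩

end IsRobustCopy

end CanFind

end PartialCopies

/-! ### Cleaning -/

section Cleaning

variable {V : Type*}

lemma exists_edges_meeting_sparse_sets {ι : Type*} {t : Finset ι}
    {S : ι → Finset V} {R : ι → V → Finset V} {M : ℕ}
    (hR : ∀ i ∈ t, ∀ u ∈ S i, (R i u).card ≤ M) (N : ι → ℕ) (κ : ℕ) :
    ∃ X : Finset (Sym2 V), κ * X.card ≤ M * ∑ i ∈ t, N i ∧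
      ∀ i ∈ t, ∀ u ∈ S i, ∀ w ∈ R i u, s(u, w) ∉ X → N i ≤ κ * (S i).card := by
  classical
  let sparse := t.filter fun i => κ * (S i).card < N i
  let X := sparse.biUnion fun i => (S i).biUnion fun u => (R i u).image fun w => s(u, w)
  have hX : X.card ≤ ∑ i ∈ sparse, (S i).card * M := by
    refine Finset.card_biUnion_le.trans (Finset.sum_le_sum fun i hi => ?_)
    refine Finset.card_biUnion_le_card_mul _ _ _ fun u hu => Finset.card_image_le.trans ?_
    exact hR i (Finset.mem_filter.1 hi).1 u hu
  refine ⟨X, ?_, fun i hi u hu w hw hwX => not_lt.1 fun hlt => hwX ?_⟩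
  · calc κ * X.card ≤ κ * ∑ i ∈ sparse, (S i).card * M := by gcongr
      _ = M * ∑ i ∈ sparse, κ * (S i).card := by simp only [Finset.mul_sum]; congr! 1; ring
      _ ≤ M * ∑ i ∈ sparse, N i := by
        gcongr with i hi; exact (Finset.mem_filter.1 hi).2.le
      _ ≤ M * ∑ i ∈ t, N i := by gcongr; exact Finset.filter_subset _ _
  · exact Finset.mem_biUnion.2 ⟨i, Finset.mem_filter.2 ⟨hi, hlt⟩,
      Finset.mem_biUnion.2 ⟨u, hu, Finset.mem_image_of_mem _ hw⟩⟩

variable {K : Type*} [Fintype V] [LinearOrder V] [Fintype K] {G : SimpleGraph V} {r M : ℕ}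

lemma mem_weakReachSet_of_adj_of_lt (hr : 1 ≤ r) {u v : V} (h : G.Adj v u) (hlt : u < v) :
    u ∈ weakReachSet G r v :=
  mem_weakReachSet.2 ⟨.cons h .nil, by simp [h.ne], by simpa using hr, by simp [hlt.le]⟩

lemma card_edgeFinset_le_of_card_weakReachSet_le [DecidableRel G.Adj] (hr : 1 ≤ r)
    (hM : ∀ v, (weakReachSet G r v).card ≤ M) : G.edgeFinset.card ≤ Fintype.card V * M := by
  have hsub : G.edgeFinset ⊆
      Finset.univ.biUnion fun v => (weakReachSet G r v).image fun u => s(v, u) := by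
    intro e he
    induction e with | _ u v
    rw [SimpleGraph.mem_edgeFinset, SimpleGraph.mem_edgeSet] at he
    simp only [Finset.mem_biUnion, Finset.mem_univ, true_and, Finset.mem_image]
    rcases he.ne.lt_or_gt with hlt | hlt
    · exact ⟨v, u, mem_weakReachSet_of_adj_of_lt hr he.symm hlt, Sym2.eq_swap⟩
    · exact ⟨u, v, mem_weakReachSet_of_adj_of_lt hr he hlt, rfl⟩
  exact (Finset.card_le_card hsub).trans (Finset.card_biUnion_le_card_mul _ _ _ fun v _ =>
    Finset.card_image_le.trans (hM v))

open scoped Classical in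
/-- The sets of neighbours of `v` that a search at `v` may have to hit: the task sets with
prescribed vertices weakly reachable from `v`, and the single weakly reachable vertices. -/
noncomputable def localTasks (G : SimpleGraph V) (r κ : ℕ) (H : SimpleGraph K) (χ : V → K) (v : V) :
    Finset (Finset V) :=
  (Finset.univ ×ˢ Fintype.piFinset fun _ => weakReachSet G r v).image
      (fun c : Finset K × (K → V) => taskSet G κ H χ v c.1 c.2) ∪
    (weakReachSet G r v).image fun b => {b}

lemma mem_localTasks {κ : ℕ} {H : SimpleGraph K} {χ : V → K} {v : V} {T : Finset V} :
    T ∈ localTasks G r κ H χ v ↔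
      (∃ C ψ, (∀ y, ψ y ∈ weakReachSet G r v) ∧ taskSet G κ H χ v C ψ = T) ∨
        ∃ b ∈ weakReachSet G r v, {b} = T := by
  simp [localTasks]

lemma card_localTasks_le (hM : ∀ v, (weakReachSet G r v).card ≤ M) (κ : ℕ) (H : SimpleGraph K)
    (χ : V → K) (v : V) : (localTasks G r κ H χ v).card ≤
      2 ^ Fintype.card K * M ^ Fintype.card K + M := by
  classical
  refine (Finset.card_union_le _ _).trans (add_le_add (Finset.card_image_le.trans ?_)
    (Finset.card_image_le.trans (hM v)))
  rw [Finset.card_product, Finset.card_univ, Fintype.card_finset, Fintype.card_piFinset,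
    Finset.prod_const, Finset.card_univ]
  gcongr
  exact hM v

/-- The number of edges deleted by the cleaning is at most this constant times `n / κ`, for a
pattern with `k` vertices and weak reachability sets of size at most `M`. -/
def cleaningConst (k M : ℕ) : ℕ := (2 ^ k * M ^ k + M) * (2 * M) + M * 2 ^ k

lemma exists_cleaning_local (hr : 1 ≤ r) (hM : ∀ v, (weakReachSet G r v).card ≤ M) (κ : ℕ)
    (H : SimpleGraph K) (χ : V → K) [DecidableRel G.Adj] :
    ∃ X : Finset (Sym2 V), κ * X.card ≤
        (2 ^ Fintype.card K * M ^ Fintype.card K + M) * (2 * M) * Fintype.card V ∧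
      ∀ v, ∀ T ∈ localTasks G r κ H χ v, ∀ u ∈ T, s(u, v) ∉ X → G.degree v ≤ κ * T.card := by
  classical
  obtain ⟨X, hX, hdense⟩ := exists_edges_meeting_sparse_sets (M := 1)
    (t := Finset.univ.sigma (localTasks G r κ H χ)) (S := fun i => i.2) (R := fun i _ => {i.1})
    (by simp) (fun i => G.degree i.1) κ
  refine ⟨X, hX.trans ?_, fun v T hT u hu => hdense ⟨v, T⟩ (by simpa using hT) u hu v (by simp)⟩
  rw [one_mul, Finset.sum_sigma]
  calc ∑ v, ∑ _T ∈ localTasks G r κ H χ v, G.degree v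
      ≤ ∑ v, (2 ^ Fintype.card K * M ^ Fintype.card K + M) * G.degree v := by
        gcongr with v
        rw [Finset.sum_const, smul_eq_mul]
        exact Nat.mul_le_mul_right _ (card_localTasks_le hM κ H χ v)
    _ = (2 ^ Fintype.card K * M ^ Fintype.card K + M) * (2 * G.edgeFinset.card) := by
        rw [← Finset.mul_sum, G.sum_degrees_eq_twice_card_edges]
    _ ≤ (2 ^ Fintype.card K * M ^ Fintype.card K + M) * (2 * (Fintype.card V * M)) := by
        gcongr; exact card_edgeFinset_le_of_card_weakReachSet_le hr hM
    _ = _ := by ring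

lemma exists_cleaning_global (hM : ∀ v, (weakReachSet G r v).card ≤ M) (κ : ℕ)
    (H : SimpleGraph K) (χ : V → K) :
    ∃ X : Finset (Sym2 V), κ * X.card ≤ M * 2 ^ Fintype.card K * Fintype.card V ∧
      ∀ C, ∀ u ∈ startSet G κ H χ C, ∀ w ∈ weakReachSet G r u, s(u, w) ∉ X →
        Fintype.card V ≤ κ * (startSet G κ H χ C).card := by
  obtain ⟨X, hX, hdense⟩ := exists_edges_meeting_sparse_sets (t := Finset.univ)
    (S := startSet G κ H χ) (R := fun _ => weakReachSet G r) (fun _ _ u _ => hM u)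
    (fun _ => Fintype.card V) κ
  refine ⟨X, hX.trans_eq ?_, fun C => hdense C (Finset.mem_univ C)⟩
  rw [Finset.sum_const, Finset.card_univ, Fintype.card_finset, smul_eq_mul, mul_assoc]

lemma exists_cleaning (hr : 1 ≤ r) (hM : ∀ v, (weakReachSet G r v).card ≤ M) (κ : ℕ)
    (H : SimpleGraph K) (χ : V → K) :
    ∃ X : Finset (Sym2 V), κ * X.card ≤ cleaningConst (Fintype.card K) M * Fintype.card V ∧
      ∀ φ : H →g G, (∀ x, χ (φ x) = x) → (∀ x y, H.Adj x y → s(φ x, φ y) ∉ X) →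
        IsRobustCopy G r κ H χ φ := by
  classical
  obtain ⟨X, hX, hlocal⟩ := exists_cleaning_local hr hM κ H χ
  obtain ⟨Y, hY, hglobal⟩ := exists_cleaning_global hM κ H χ
  refine ⟨X ∪ Y, ?_, fun φ hcol havoid => ?_⟩
  · calc κ * (X ∪ Y).card ≤ κ * (X.card + Y.card) := by gcongr; exact Finset.card_union_le _ _
      _ ≤ _ := by rw [mul_add, cleaningConst, add_mul]; exact add_le_add hX hY
  have hmem : ∀ h b, H.Adj h b → φ b < φ h → φ b ∈ weakReachSet G r (φ h) := fun h b hb =>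
    mem_weakReachSet_of_adj_of_lt hr (φ.map_adj hb)
  refine ⟨hcol, fun h b hb hlt => ?_, fun h g hg C ψ hψ hgT => ?_, fun h b hb hlt C hC => ?_⟩
  · have hT : {φ b} ∈ localTasks G r κ H χ (φ h) :=
      mem_localTasks.2 (.inr ⟨φ b, hmem h b hb hlt, rfl⟩)
    simpa using hlocal _ _ hT (φ b) (Finset.mem_singleton_self _)
      (mt (Finset.mem_union_left Y) (havoid b h hb.symm))
  · have hT : taskSet G κ H χ (φ h) C ψ ∈ localTasks G r κ H χ (φ h) :=
      mem_localTasks.2 (.inl ⟨C, ψ, hψ, rfl⟩)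
    exact hlocal _ _ hT (φ g) hgT (mt (Finset.mem_union_left Y) (havoid g h hg.symm))
  · exact hglobal C (φ h) hC (φ b) (hmem h b hb hlt)
      (mt (Finset.mem_union_right X) (havoid h b hb))

end Cleaning

/-! ### Many coloured copies -/

section Copies

variable {V K : Type*} [Fintype K]

open scoped Classical in
/-- The edges of the image of `H` under `φ`. -/
noncomputable def copyEdges (H : SimpleGraph K) (φ : K → V) : Finset (Sym2 V) :=
  H.edgeFinset.image (Sym2.map φ)

lemma mem_copyEdges {H : SimpleGraph K} {φ : K → V} {x y : K} (h : H.Adj x y) :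
    s(φ x, φ y) ∈ copyEdges H φ := by
  classical
  exact Finset.mem_image.2 ⟨s(x, y), by simpa using h, rfl⟩

open scoped Classical in
lemma card_copyEdges_le (H : SimpleGraph K) (φ : K → V) :
    (copyEdges H φ).card ≤ Fintype.card K ^ 2 := by
  calc (copyEdges H φ).card ≤ H.edgeFinset.card := Finset.card_image_le
    _ ≤ (Fintype.card K).choose 2 := H.card_edgeFinset_le_card_choose_two
    _ ≤ Fintype.card K ^ 2 := Nat.choose_le_pow _ _

lemma exists_disjoint_copies [Finite V] (G : SimpleGraph V) {H : SimpleGraph K} (hH : H ≠ ⊥) :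
    ∃ P : Finset (H.Copy G), (P : Set (H.Copy G)).PairwiseDisjoint (fun φ => copyEdges H φ) ∧
      H.Free (G.deleteEdges {e | ∃ φ ∈ P, e ∈ copyEdges H φ}) := by
  classical
  have : Finite (H.Copy G) := Finite.of_injective (fun φ => (φ : K → V)) DFunLike.coe_injective
  obtain ⟨P, hP⟩ := Set.Finite.exists_maximal (Set.toFinite {P : Finset (H.Copy G) |
    (P : Set (H.Copy G)).PairwiseDisjoint (fun φ => copyEdges H φ)}) ⟨∅, by simp⟩
  refine ⟨P, hP.prop, fun ⟨f⟩ => ?_⟩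
  let φ : H.Copy G := (SimpleGraph.Copy.ofLE _ _ (G.deleteEdges_le _)).comp f
  have hnew : ∀ ψ ∈ P, Disjoint (copyEdges H φ) (copyEdges H ψ) := by
    refine fun ψ hψ => Finset.disjoint_left.2 fun e he heψ => ?_
    obtain ⟨e', he', rfl⟩ := Finset.mem_image.1 he
    induction e' with | _ x y
    have hadj := f.toHom.map_adj (show H.Adj x y by simpa using he')
    exact ((SimpleGraph.deleteEdges_adj ..).1 hadj).2 ⟨ψ, hψ, heψ⟩
  have hφP : φ ∈ P :=
    hP.le_of_ge (y := insert φ P) (by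
      simpa [Set.pairwiseDisjoint_insert] using ⟨hP.prop, fun ψ hψ _ => hnew ψ hψ⟩)
      (Finset.subset_insert _ _) (Finset.mem_insert_self _ _)
  obtain ⟨x, y, hxy⟩ := SimpleGraph.ne_bot_iff_exists_adj.1 hH
  exact Finset.disjoint_left.1 (hnew φ hφP) (mem_copyEdges hxy) (mem_copyEdges hxy)

variable [DecidableEq K]

lemma card_le_mul_card_properColorings [Fintype V] [DecidableEq V] {φ : K → V}
    (hφ : Function.Injective φ) :
    Fintype.card (V → K) ≤ Fintype.card K ^ Fintype.card K *
      (Finset.univ.filter fun χ : V → K => ∀ x, χ (φ x) = x).card := by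
  have hinj : Set.InjOn (fun χ : V → K => (χ ∘ φ, Function.extend φ id χ)) Set.univ := by
    intro χ _ χ' _ h
    obtain ⟨h1, h2⟩ := Prod.ext_iff.1 h
    funext v
    by_cases hv : ∃ x, φ x = v
    · obtain ⟨x, rfl⟩ := hv
      exact congrFun h1 x
    · simpa [Function.extend_apply' _ _ _ hv] using congrFun h2 v
  calc Fintype.card (V → K) ≤ ((Finset.univ : Finset (K → K)) ×ˢ
        Finset.univ.filter fun χ : V → K => ∀ x, χ (φ x) = x).card :=
        Finset.card_le_card_of_injOn (fun χ => (χ ∘ φ, Function.extend φ id χ))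
          (fun χ _ => by simp [hφ.extend_apply]) (by simpa using hinj)
    _ = _ := by simp

lemma exists_coloring_card_le [Finite V] [Nonempty K] {ι : Type*} (P : Finset ι) {φ : ι → K → V}
    (hφ : ∀ i ∈ P, Function.Injective (φ i)) : ∃ χ : V → K, P.card ≤
      Fintype.card K ^ Fintype.card K * (P.filter fun i => ∀ x, χ (φ i x) = x).card := by
  classical
  have := Fintype.ofFinite V
  have havg : ∑ _χ : V → K, P.card ≤ ∑ χ : V → K,
      Fintype.card K ^ Fintype.card K * (P.filter fun i => ∀ x, χ (φ i x) = x).card := by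
    simp only [← Finset.mul_sum, Finset.card_filter]
    rw [Finset.sum_comm, Finset.mul_sum, Finset.sum_const, Finset.card_univ, smul_eq_mul, mul_comm,
      ← smul_eq_mul, ← Finset.sum_const]
    refine Finset.sum_le_sum fun i hi => ?_
    simpa only [Finset.card_filter] using card_le_mul_card_properColorings (hφ i hi)
  obtain ⟨χ, -, hχ⟩ := Finset.exists_le_of_sum_le Finset.univ_nonempty havg
  exact ⟨χ, hχ⟩

end Copies

section Far

variable {V K : Type*} [Fintype K] {G : SimpleGraph V}

/-- The density parameter of the exploration of graphs with `r`-admissibility at most `p` from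
which at least `n / d` edges have to be deleted to remove all copies of a graph on `k` vertices. -/
def densityConst (k r p d : ℕ) : ℕ :=
  d * k ^ 2 * k ^ k * cleaningConst k ((p * r + 1) ^ r) + 1

lemma exists_forall_notMem_copyEdges {H : SimpleGraph K} {P : Finset (H.Copy G)}
    (hP : (P : Set (H.Copy G)).PairwiseDisjoint (fun φ => copyEdges H φ)) {X : Finset (Sym2 V)}
    (hX : X.card < P.card) : ∃ φ ∈ P, Disjoint (copyEdges H φ) X := by
  classical
  by_contra! hmeet
  have hmeet : ∀ φ ∈ P, ∃ e ∈ X, e ∈ copyEdges H φ := fun φ hφ => by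
    obtain ⟨e, he, heX⟩ := Finset.not_disjoint_iff.1 (hmeet φ hφ)
    exact ⟨e, heX, he⟩
  have : Nonempty (Sym2 V) := (Finset.card_pos.1 (Nat.zero_lt_of_lt hX)).elim fun φ hφ =>
    ⟨(hmeet φ hφ).choose⟩
  choose! f hfX hf using hmeet
  obtain ⟨φ, hφ, ψ, hψ, hne, hfe⟩ := Finset.exists_ne_map_eq_of_card_lt_of_maps_to hX hfX
  exact Finset.disjoint_left.1 (hP hφ hψ hne) (hf φ hφ) (hfe ▸ hf ψ hψ)

variable [Fintype V]

lemma exists_coloredCopies_of_far [Nonempty K] {H : SimpleGraph K} (hH : H ≠ ⊥) {d : ℕ}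
    (hfar : ∀ X : Finset (Sym2 V), H.Free (G.deleteEdges X) → Fintype.card V ≤ d * X.card) :
    ∃ (χ : V → K) (P : Finset (H.Copy G)), (∀ φ ∈ P, ∀ x, χ (φ x) = x) ∧
      (P : Set (H.Copy G)).PairwiseDisjoint (fun φ => copyEdges H φ) ∧
      Fintype.card V ≤ d * Fintype.card K ^ 2 * Fintype.card K ^ Fintype.card K * P.card := by
  classical
  obtain ⟨P, hdisj, hfree⟩ := exists_disjoint_copies G hH
  obtain ⟨χ, hχ⟩ := exists_coloring_card_le P (φ := fun φ => φ) fun φ _ => φ.injective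
  refine ⟨χ, P.filter fun φ => ∀ x, χ (φ x) = x, fun φ hφ => (Finset.mem_filter.1 hφ).2,
    hdisj.subset (Finset.coe_subset.2 (Finset.filter_subset _ P)), ?_⟩
  calc Fintype.card V ≤ d * (P.biUnion fun φ => copyEdges H φ).card :=
        hfar _ (by convert hfree; ext; simp)
    _ ≤ d * (P.card * Fintype.card K ^ 2) := by
        gcongr; exact Finset.card_biUnion_le_card_mul _ _ _ fun φ _ => card_copyEdges_le H φ
    _ ≤ d * (Fintype.card K ^ Fintype.card K *
          (P.filter fun φ => ∀ x, χ (φ x) = x).card * Fintype.card K ^ 2) := by gcongr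
    _ = _ := by ring

theorem canReach_isContained_of_far [Nonempty V] {H : SimpleGraph K} {r p d : ℕ}
    (h : adm G r ≤ p) (hr : Fintype.card K ≤ r)
    (hfar : ∀ X : Finset (Sym2 V), H.Free (G.deleteEdges X) → Fintype.card V ≤ d * X.card) :
    CanReach G (densityConst (Fintype.card K) r p d)
      (fun s => H.IsContained s.spanningCoe)
      (Fintype.card K * (budget (Fintype.card K) (Fintype.card K) + 1)) ⊥ := by
  classical
  obtain rfl | hH := eq_or_ne H ⊥
  · have hcopy : (⊥ : SimpleGraph K).IsContained G := by
      by_contra hfree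
      simpa using hfar ∅ (by simpa using hfree)
    exact .done (SimpleGraph.bot_isContained_iff_card_le.2
      (SimpleGraph.bot_isContained_iff_card_le.1 hcopy))
  have : Nonempty K := let ⟨x, _⟩ := SimpleGraph.ne_bot_iff_exists_adj.1 hH; ⟨x⟩
  obtain ⟨_, hM⟩ := exists_linearOrder_card_weakReachSet_le h
  obtain ⟨χ, P, hcol, hdisj, hcard⟩ := exists_coloredCopies_of_far hH hfar
  obtain ⟨X, hX, hclean⟩ := exists_cleaning (Fintype.card_pos.trans_le hr) hM
    (densityConst (Fintype.card K) r p d) H χ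
  have hXP : X.card < P.card := by
    by_contra! hle
    set c := cleaningConst (Fintype.card K) ((p * r + 1) ^ r)
    set m := d * Fintype.card K ^ 2 * Fintype.card K ^ Fintype.card K
    have hXm : (m * c + 1) * X.card ≤ m * c * X.card := calc
      (m * c + 1) * X.card ≤ c * Fintype.card V := hX
      _ ≤ c * (m * X.card) := by gcongr; exact hcard.trans (by gcongr)
      _ = m * c * X.card := by ring
    have hX0 : X.card = 0 := by linarith
    have : 0 < Fintype.card V := Fintype.card_pos
    simp_all
  obtain ⟨φ, hφ, hφX⟩ := exists_forall_notMem_copyEdges hdisj hXP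
  exact (hclean φ.toHom (hcol φ hφ) fun x y hxy =>
    Finset.disjoint_left.1 hφX (mem_copyEdges hxy)).canReach_isContained hr

end Far

/-! ### Iterating a random step -/

section Chain

open scoped ENNReal

variable {α β : Type*}

lemma toOuterMeasure_add_compl (p : PMF α) (s : Set α) :
    p.toOuterMeasure s + p.toOuterMeasure sᶜ = 1 := by
  have hs : p.toOuterMeasure.IsCaratheodory s := p.toOuterMeasure_caratheodory.ge s trivial
  have huniv : p.toOuterMeasure Set.univ = 1 :=
    (p.toOuterMeasure_apply_eq_one_iff _).2 (Set.subset_univ _)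
  rw [← huniv, hs Set.univ, Set.univ_inter, Set.compl_eq_univ_sdiff]

lemma mul_le_toOuterMeasure_bind {p : PMF α} {f : α → PMF β} {s : Set α} {t : Set β} {c : ℝ≥0∞}
    (h : ∀ a ∈ s, c ≤ (f a).toOuterMeasure t) :
    p.toOuterMeasure s * c ≤ (p.bind f).toOuterMeasure t := by
  rw [PMF.toOuterMeasure_apply, PMF.toOuterMeasure_bind_apply, ← ENNReal.tsum_mul_right]
  refine ENNReal.tsum_le_tsum fun a => ?_
  by_cases ha : a ∈ s
  · rw [Set.indicator_of_mem ha]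
    exact mul_le_mul_right (h a ha) _
  · rw [Set.indicator_of_notMem ha, zero_mul]
    exact zero_le

lemma toOuterMeasure_bind_le_mul {p : PMF α} {f : α → PMF β} {s : Set α} {t : Set β} {c : ℝ≥0∞}
    (hc : ∀ a ∈ s, (f a).toOuterMeasure t ≤ c) (h0 : ∀ a ∉ s, (f a).toOuterMeasure t = 0) :
    (p.bind f).toOuterMeasure t ≤ p.toOuterMeasure s * c := by
  rw [PMF.toOuterMeasure_bind_apply, PMF.toOuterMeasure_apply p s, ← ENNReal.tsum_mul_right]
  refine ENNReal.tsum_le_tsum fun a => ?_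
  by_cases ha : a ∈ s
  · rw [Set.indicator_of_mem ha]
    exact mul_le_mul_right (hc a ha) _
  · rw [h0 a ha, mul_zero]
    exact zero_le

/-- The distribution after `t` random steps `f` of a Markov chain started at `a`. -/
noncomputable def chain (f : α → PMF α) : ℕ → α → PMF α
  | 0, a => PMF.pure a
  | t + 1, a => (f a).bind (chain f t)

variable {f : α → PMF α} {s : Set α}

lemma chain_one (a : α) : chain f 1 a = f a :=
  PMF.bind_pure _

lemma chain_add (t u : ℕ) (a : α) : chain f (t + u) a = (chain f t a).bind (chain f u) := by
  induction t generalizing a with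
  | zero => rw [Nat.zero_add, chain, PMF.pure_bind]
  | succ t ih =>
    rw [Nat.succ_add, chain, chain, PMF.bind_bind]
    exact congrArg _ (funext ih)

lemma support_chain_subset (hs : ∀ a ∈ s, (f a).support ⊆ s) {a : α} (ha : a ∈ s) (t : ℕ) :
    (chain f t a).support ⊆ s := by
  induction t generalizing a with
  | zero => simpa [chain] using ha
  | succ t ih =>
    intro b hb
    obtain ⟨c, hc, hb⟩ := (PMF.mem_support_bind_iff _ _ _).1 hb
    exact ih (hs a ha hc) hb

lemma toOuterMeasure_chain_compl_le (hs : ∀ a ∈ s, (f a).support ⊆ s) {J : ℕ} {δ : ℝ≥0∞}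
    (hδ : ∀ a, δ ≤ (chain f J a).toOuterMeasure s) (i : ℕ) (a : α) :
    (chain f (J * i) a).toOuterMeasure sᶜ ≤ (1 - δ) ^ i := by
  induction i generalizing a with
  | zero =>
    rw [pow_zero, ← toOuterMeasure_add_compl _ s]
    exact le_add_self
  | succ i ih =>
    rw [mul_add_one, add_comm, chain_add, pow_succ']
    refine (toOuterMeasure_bind_le_mul (s := sᶜ) (fun b _ => ih b) fun b hb => ?_).trans
      (mul_le_mul_left ?_ _)
    · rw [PMF.toOuterMeasure_apply_eq_zero_iff, Set.disjoint_compl_right_iff_subset]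
      exact support_chain_subset hs (not_not.1 hb) _
    · rw [ENNReal.eq_sub_of_add_eq' ENNReal.one_ne_top
        ((add_comm _ _).trans (toOuterMeasure_add_compl _ s))]
      exact tsub_le_tsub_left (hδ a) 1

lemma one_sub_inv_pow_le {Q : ℕ} (hQ : 0 < Q) : (1 - (Q : ℝ≥0∞)⁻¹) ^ (2 * Q) ≤ 3⁻¹ := by
  have hQ' : (0 : ℝ) < Q := by exact_mod_cast hQ
  have hofReal : 1 - (Q : ℝ≥0∞)⁻¹ = ENNReal.ofReal (1 - (Q : ℝ)⁻¹) := by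
    rw [ENNReal.ofReal_sub _ (by positivity), ENNReal.ofReal_one, ENNReal.ofReal_inv_of_pos hQ',
      ENNReal.ofReal_natCast]
  have hnonneg : 0 ≤ 1 - (Q : ℝ)⁻¹ :=
    sub_nonneg.2 (inv_le_one_of_one_le₀ (by exact_mod_cast hQ))
  have hreal : (1 - (Q : ℝ)⁻¹) ^ (2 * Q) ≤ 3⁻¹ := by
    calc (1 - (Q : ℝ)⁻¹) ^ (2 * Q)
      _ ≤ Real.exp (-(Q : ℝ)⁻¹) ^ (2 * Q) := by
          gcongr
          exact Real.one_sub_le_exp_neg _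
      _ = (Real.exp 2)⁻¹ := by
          rw [← Real.exp_nat_mul, ← Real.exp_neg]
          congr 1
          push_cast
          field_simp
      _ ≤ 3⁻¹ := by
          gcongr
          linarith [Real.add_one_le_exp (2 : ℝ)]
  calc (1 - (Q : ℝ≥0∞)⁻¹) ^ (2 * Q)
    _ = ENNReal.ofReal ((1 - (Q : ℝ)⁻¹) ^ (2 * Q)) := by rw [hofReal, ENNReal.ofReal_pow hnonneg]
    _ ≤ ENNReal.ofReal 3⁻¹ := ENNReal.ofReal_le_ofReal hreal
    _ = 3⁻¹ := by rw [ENNReal.ofReal_inv_of_pos (by norm_num), ENNReal.ofReal_ofNat]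

lemma two_thirds_le_toOuterMeasure_chain (hs : ∀ a ∈ s, (f a).support ⊆ s) {J Q : ℕ} (hQ : 0 < Q)
    (hδ : ∀ a, (Q : ℝ≥0∞)⁻¹ ≤ (chain f J a).toOuterMeasure s) (a : α) :
    2 / 3 ≤ (chain f (J * (2 * Q)) a).toOuterMeasure s := by
  set p := chain f (J * (2 * Q)) a
  have hcompl : p.toOuterMeasure sᶜ ≤ 3⁻¹ :=
    (toOuterMeasure_chain_compl_le hs hδ _ a).trans (one_sub_inv_pow_le hQ)
  have hsum : (2 / 3 : ℝ≥0∞) + 3⁻¹ = 1 := by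
    rw [div_eq_mul_inv, ← add_one_mul, show (2 : ℝ≥0∞) + 1 = 3 by norm_num,
      ENNReal.mul_inv_cancel (by simp) (by simp)]
  refine (ENNReal.add_le_add_iff_right (a := 3⁻¹) (by simp)).1 ?_
  calc 2 / 3 + 3⁻¹
    _ = p.toOuterMeasure s + p.toOuterMeasure sᶜ := by rw [hsum, toOuterMeasure_add_compl]
    _ ≤ p.toOuterMeasure s + 3⁻¹ := add_le_add_right hcompl _

end Chain

/-! ### Uniform guesses -/

section Uniform

open scoped ENNReal

lemma inv_le_toOuterMeasure_uniformOfFinset {α : Type*} {s : Finset α} (hs : s.Nonempty)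
    {t : Set α} {u : Finset α} (hus : u ⊆ s) (hut : ∀ a ∈ u, a ∈ t) {κ : ℕ}
    (hcard : s.card ≤ κ * u.card) :
    (κ : ℝ≥0∞)⁻¹ ≤ (PMF.uniformOfFinset s hs).toOuterMeasure t := by
  classical
  have hspos : 0 < s.card := hs.card_pos
  have hκ : (κ : ℝ≥0∞) ≠ 0 := by
    rw [Nat.cast_ne_zero]
    rintro rfl
    omega
  have hle : u.card ≤ (s.filter (· ∈ t)).card :=
    Finset.card_le_card fun a ha => Finset.mem_filter.2 ⟨hus ha, hut a ha⟩
  rw [PMF.toOuterMeasure_uniformOfFinset_apply,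
    ENNReal.le_div_iff_mul_le (Or.inl (by simpa using hspos.ne')) (Or.inl (by simp)), mul_comm,
    ← div_eq_mul_inv, ENNReal.div_le_iff hκ (by simp), mul_comm]
  exact_mod_cast hcard.trans (Nat.mul_le_mul_left κ hle)

variable {n w M : ℕ} [Nonempty (Fin M)]

lemma inv_le_toOuterMeasure_mod (hM : M = w * n) {κ : ℕ} {S : Finset (Fin n)}
    (hS : n ≤ κ * S.card) :
    (κ : ℝ≥0∞)⁻¹ ≤ (PMF.uniformOfFintype (Fin M)).toOuterMeasure
      {c | ∃ u ∈ S, (u : ℕ) = c % n} := by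
  subst hM
  refine inv_le_toOuterMeasure_uniformOfFinset _ (u := (Finset.univ ×ˢ S).map
    finProdFinEquiv.toEmbedding) (Finset.subset_univ _) ?_ ?_
  · simp only [Finset.mem_map, Finset.mem_product, Finset.mem_univ, true_and, Set.mem_ofPred_eq]
    rintro _ ⟨⟨i, u⟩, hu, rfl⟩
    refine ⟨u, hu, ?_⟩
    simp [Nat.mod_eq_of_lt u.2]
  · rw [Finset.card_map, Finset.card_product, Finset.card_univ, Finset.card_univ, Fintype.card_fin,
      Fintype.card_fin]
    calc w * n ≤ w * (κ * S.card) := Nat.mul_le_mul_left w hS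
      _ = κ * (w * S.card) := Nat.mul_left_comm ..

lemma inv_le_toOuterMeasure_div (hM : M = w * n) {i : ℕ} (hi : i < w) :
    (w : ℝ≥0∞)⁻¹ ≤ (PMF.uniformOfFintype (Fin M)).toOuterMeasure {c | (c : ℕ) / n = i} := by
  subst hM
  refine inv_le_toOuterMeasure_uniformOfFinset _ (u := (({⟨i, hi⟩} : Finset (Fin w)) ×ˢ
    Finset.univ).map finProdFinEquiv.toEmbedding) (Finset.subset_univ _) ?_ ?_
  · simp only [Finset.mem_map, Finset.mem_product, Finset.mem_singleton, Set.mem_ofPred_eq]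
    rintro _ ⟨⟨j, u⟩, ⟨rfl, -⟩, rfl⟩
    simp [Nat.add_mul_div_left _ _ u.pos, Nat.div_eq_of_lt u.2]
  · simp

end Uniform

/-! ### The exploration algorithm -/

section Transcript

/-- The vertex of a graph with `n` vertices that an entry of a transcript reveals: the answer of
the oracle, or the residue modulo `n` of a random number. -/
def entryVertex (n : ℕ) : Entry → Option ℕ
  | Sum.inl z => z.2
  | Sum.inr c => some (c % n)

/-- The edge revealed by an entry of a transcript. -/
def entryEdge : Entry → Option (ℕ × ℕ)
  | Sum.inl z => z.2.map fun u => (z.1, u)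
  | Sum.inr _ => none

/-- The vertices revealed by a transcript, the most recent one first. -/
def revealedVertices (n : ℕ) (tr : List Entry) : List ℕ := tr.filterMap (entryVertex n)

/-- The edges revealed by a transcript. -/
def revealedEdges (tr : List Entry) : List (ℕ × ℕ) := tr.filterMap entryEdge

/-- The graph on `n` vertices formed by the edges that a transcript reveals. -/
def revealedGraph (n : ℕ) (tr : List Entry) : SimpleGraph (Fin n) :=
  SimpleGraph.fromRel fun v u => ((v : ℕ), (u : ℕ)) ∈ revealedEdges tr

/-- The vertex to be queried after the transcript `tr` and the random number `c`: the quotient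
`c / n` is an index into the list of revealed vertices, which starts with `c % n`. -/
def queryVertex (n c : ℕ) (tr : List Entry) : ℕ :=
  (revealedVertices n (Sum.inr c :: tr)).getD (c / n) 0

/-- The explorer alternates between drawing a random number below `n * w` and querying the vertex
which that number encodes. -/
def nextAction (n w : ℕ) : List Entry → ℕ ⊕ ℕ
  | Sum.inr c :: tr => Sum.inl (queryVertex n c tr)
  | _ => Sum.inr (n * w - 1)

/-- The algorithm which explores for `N` steps with window size `w` and then outputs `verdict`. -/
def explorer (N : Params → ℕ) (w : ℕ) (verdict : Params × List Entry → Bool) : OracleAlgorithm :=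
  fun z => if N z.1 ≤ z.2.length then Sum.inl (verdict z) else Sum.inr (nextAction z.1.1 w z.2)

/-- Two consecutive steps of the explorer: a random draw and the query which it determines. -/
noncomputable def exploreRound (w : ℕ) {n : ℕ} (G : SimpleGraph (Fin n)) (tr : List Entry) :
    PMF (List Entry) :=
  (PMF.uniformOfFintype (Fin (n * w - 1 + 1))).bind fun c : Fin (n * w - 1 + 1) =>
    (oracleAnswer G (queryVertex n c tr)).map fun a =>
      Sum.inl (queryVertex n c tr, a) :: Sum.inr (c : ℕ) :: tr

variable {n : ℕ}

lemma revealedEdges_subset_cons (e : Entry) (tr : List Entry) :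
    revealedEdges tr ⊆ revealedEdges (e :: tr) :=
  ((List.sublist_cons_self e tr).filterMap entryEdge).subset

lemma revealedGraph_adj {tr : List Entry} {v u : Fin n} :
    (revealedGraph n tr).Adj v u ↔
      v ≠ u ∧ (((v : ℕ), (u : ℕ)) ∈ revealedEdges tr ∨ ((u : ℕ), (v : ℕ)) ∈ revealedEdges tr) :=
  SimpleGraph.fromRel_adj _ _ _

lemma revealedGraph_le_cons (e : Entry) (tr : List Entry) :
    revealedGraph n tr ≤ revealedGraph n (e :: tr) := by
  intro v u h
  rw [revealedGraph_adj] at h ⊢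
  exact h.imp id (Or.imp (fun h => revealedEdges_subset_cons e tr h)
    (fun h => revealedEdges_subset_cons e tr h))

end Transcript

/-! ### Runs of the explorer -/

section Run

variable {T : OracleAlgorithm} {x : Params} {n : ℕ} {G : SimpleGraph (Fin n)}

open Classical in
lemma oracleAnswer_eq {v : Fin n} (h : (G.neighborFinset v).Nonempty) :
    oracleAnswer G v = (PMF.uniformOfFinset (G.neighborFinset v) h).map
      fun u : Fin n => some (u : ℕ) := by
  rw [oracleAnswer, dif_pos ⟨v.2, h⟩]
  change PMF.map _ (PMF.bind _ fun a : Fin n => PMF.pure (a : ℕ)) = _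
  rw [PMF.map_bind]
  simp only [PMF.pure_map]
  exact PMF.bind_pure_comp _ _

lemma adj_of_some_mem_support_oracleAnswer {v u : ℕ} (h : some u ∈ (oracleAnswer G v).support) :
    ∃ (hv : v < n) (hu : u < n), G.Adj ⟨v, hv⟩ ⟨u, hu⟩ := by
  classical
  by_cases hne : ∃ hv : v < n, (G.neighborFinset ⟨v, hv⟩).Nonempty
  · obtain ⟨hv, hne⟩ := hne
    have heq := oracleAnswer_eq hne
    rw [Fin.val_mk] at heq
    rw [heq, PMF.mem_support_map_iff] at h
    obtain ⟨u, hu, rfl⟩ := by simpa using h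
    exact ⟨hv, u.2, hu⟩
  · rw [oracleAnswer, dif_neg hne] at h
    simp at h

lemma step_of_draw {tr : List Entry} {m : ℕ} (h : T (x, tr) = Sum.inr (Sum.inr m)) :
    step T x G tr = (PMF.uniformOfFintype (Fin (m + 1))).map
      fun c : Fin (m + 1) => Sum.inr (c : ℕ) :: tr := by
  simp only [step, h]
  change PMF.map _ (PMF.bind _ fun c : Fin (m + 1) => PMF.pure (c : ℕ)) = _
  rw [PMF.map_bind]
  simp only [PMF.pure_map]
  exact PMF.bind_pure_comp _ _

lemma mem_support_step {tr tr' : List Entry} (h : tr' ∈ (step T x G tr).support) :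
    (tr' = tr ∧ ∃ b, T (x, tr) = Sum.inl b) ∨
      (∃ a, T (x, tr) = Sum.inr a) ∧ ∃ e, tr' = e :: tr ∧
        ∀ v u, entryEdge e = some (v, u) → ∃ (hv : v < n) (hu : u < n), G.Adj ⟨v, hv⟩ ⟨u, hu⟩ := by
  rcases hT : T (x, tr) with b | v | m
  · simp only [step, hT, PMF.support_pure, Set.mem_singleton_iff] at h
    exact Or.inl ⟨h, b, rfl⟩
  · simp only [step, hT, PMF.mem_support_map_iff] at h
    obtain ⟨a, ha, rfl⟩ := h
    refine Or.inr ⟨⟨_, rfl⟩, _, rfl, fun v' u' he => ?_⟩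
    obtain ⟨u, rfl, rfl, rfl⟩ : ∃ u, a = some u ∧ v = v' ∧ u = u' := by
      simpa [entryEdge] using he
    exact adj_of_some_mem_support_oracleAnswer ha
  · rw [step_of_draw hT, PMF.mem_support_map_iff] at h
    obtain ⟨c, -, rfl⟩ := h
    exact Or.inr ⟨⟨_, rfl⟩, _, rfl, by simp [entryEdge]⟩

lemma revealedGraph_le_of_mem_support_run {t : ℕ} {tr : List Entry}
    (h : tr ∈ (run T x G t).support) : revealedGraph n tr ≤ G := by
  suffices hadj : ∀ v u, (v, u) ∈ revealedEdges tr →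
      ∃ (hv : v < n) (hu : u < n), G.Adj ⟨v, hv⟩ ⟨u, hu⟩ by
    intro v u hvu
    rcases (revealedGraph_adj.1 hvu).2 with hmem | hmem
    exacts [(hadj _ _ hmem).2.2, (hadj _ _ hmem).2.2.symm]
  induction t generalizing tr with
  | zero =>
    obtain rfl : tr = [] := by simpa [run] using h
    simp [revealedEdges]
  | succ t ih =>
    obtain ⟨tr₀, h₀, hstep⟩ := (PMF.mem_support_bind_iff _ _ _).1 h
    rcases mem_support_step hstep with ⟨rfl, -⟩ | ⟨-, e, rfl, he⟩
    · exact ih h₀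
    · intro v u hmem
      obtain ⟨e', he', hvu⟩ := List.mem_filterMap.1 hmem
      rcases List.mem_cons.1 he' with rfl | he'
      exacts [he v u hvu, ih h₀ v u (List.mem_filterMap.2 ⟨e', he', hvu⟩)]

lemma verdictProb_le_one (b : Bool) : verdictProb T x G b ≤ 1 :=
  iSup_le fun _ => PMF.coe_le_one _ _

variable {N : Params → ℕ} {w : ℕ} {verdict : Params × List Entry → Bool}

lemma explorer_of_le {tr : List Entry} (h : N x ≤ tr.length) :
    explorer N w verdict (x, tr) = Sum.inl (verdict (x, tr)) :=
  if_pos h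

lemma explorer_of_lt {tr : List Entry} (h : tr.length < N x) :
    explorer N w verdict (x, tr) = Sum.inr (nextAction x.1 w tr) :=
  if_neg h.not_ge

lemma length_of_mem_support_run {t : ℕ} {tr : List Entry}
    (h : tr ∈ (run (explorer N w verdict) x G t).support) : tr.length = min t (N x) := by
  induction t generalizing tr with
  | zero =>
    obtain rfl : tr = [] := by simpa [run] using h
    simp
  | succ t ih =>
    obtain ⟨tr₀, h₀, hstep⟩ := (PMF.mem_support_bind_iff _ _ _).1 h
    have hlen := ih h₀
    rcases mem_support_step hstep with ⟨rfl, b, hb⟩ | ⟨⟨a, ha⟩, e, rfl, -⟩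
    · have : N x ≤ tr.length := by
        by_contra! hlt
        simp [explorer_of_lt hlt] at hb
      omega
    · have : tr₀.length < N x := by
        by_contra! hle
        simp [explorer_of_le hle] at ha
      rw [List.length_cons]
      omega

lemma explorer_eq_of_mem_support_run {tr : List Entry}
    (h : tr ∈ (run (explorer N w verdict) x G (N x)).support) :
    explorer N w verdict (x, tr) = Sum.inl (verdict (x, tr)) :=
  explorer_of_le ((length_of_mem_support_run h).trans (min_self _)).ge

lemma halts_explorer : Halts (explorer N w verdict) x G :=
  ⟨N x, fun _ h => ⟨_, explorer_eq_of_mem_support_run h⟩⟩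

lemma queriesAtMost_explorer : QueriesAtMost (explorer N w verdict) x G (N x) := fun _ _ h =>
  List.countP_le_length.trans ((length_of_mem_support_run h).trans_le (min_le_right _ _))

lemma toOuterMeasure_verdict_le (b : Bool) :
    (run (explorer N w verdict) x G (N x)).toOuterMeasure {tr | verdict (x, tr) = b} ≤
      verdictProb (explorer N w verdict) x G b := by
  refine le_trans ?_ (le_iSup (fun t => ((run (explorer N w verdict) x G t).map
    fun tr => explorer N w verdict (x, tr)) (Sum.inl b)) (N x))
  rw [← PMF.toOuterMeasure_apply_singleton, PMF.toOuterMeasure_map_apply]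
  refine PMF.toOuterMeasure_mono _ fun tr htr => ?_
  rw [Set.mem_preimage, explorer_eq_of_mem_support_run htr.2, htr.1]
  rfl

lemma step_bind_step_explorer {y : ℕ × ℕ} {tr : List Entry} (hlen : tr.length + 2 ≤ N (n, y))
    (htr : nextAction n w tr = Sum.inr (n * w - 1)) :
    (step (explorer N w verdict) (n, y) G tr).bind (step (explorer N w verdict) (n, y) G) =
      exploreRound w G tr := by
  have hdraw : explorer N w verdict ((n, y), tr) = Sum.inr (Sum.inr (n * w - 1)) := by
    rw [explorer_of_lt (by omega), htr]
  rw [step_of_draw hdraw, PMF.bind_map, exploreRound]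
  refine congrArg _ (funext fun c => ?_)
  have hquery : explorer N w verdict ((n, y), Sum.inr (c : ℕ) :: tr) =
      Sum.inr (Sum.inl (queryVertex n c tr)) :=
    explorer_of_lt (by rw [List.length_cons]; omega)
  simp only [Function.comp_apply, step, hquery]

lemma nextAction_of_mem_support_chain {t : ℕ} {tr : List Entry}
    (h : tr ∈ (chain (exploreRound w G) t []).support) :
    nextAction n w tr = Sum.inr (n * w - 1) := by
  refine support_chain_subset (s := {tr | nextAction n w tr = Sum.inr (n * w - 1)})
    (fun tr₀ _ tr₁ h₁ => ?_) rfl t h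
  obtain ⟨c, -, h₁⟩ := (PMF.mem_support_bind_iff _ _ _).1 h₁
  obtain ⟨a, -, rfl⟩ := (PMF.mem_support_map_iff _ _ _).1 h₁
  rfl

lemma run_explorer_two_mul {y : ℕ × ℕ} {t : ℕ} (ht : 2 * t ≤ N (n, y)) :
    run (explorer N w verdict) (n, y) G (2 * t) = chain (exploreRound w G) t [] := by
  induction t with
  | zero => rfl
  | succ t ih =>
    have ih := ih (by omega)
    rw [show 2 * (t + 1) = 2 * t + 1 + 1 by ring, run, run, PMF.bind_bind, chain_add, ← ih]
    refine PMF.ext fun tr' => ?_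
    rw [PMF.bind_apply, PMF.bind_apply]
    refine tsum_congr fun tr => ?_
    by_cases htr : tr ∈ (run (explorer N w verdict) (n, y) G (2 * t)).support
    · have hlen := length_of_mem_support_run htr
      rw [step_bind_step_explorer (by omega) (nextAction_of_mem_support_chain (ih ▸ htr)),
        chain_one]
    · rw [(PMF.apply_eq_zero_iff _ _).2 htr, zero_mul, zero_mul]

end Run

/-! ### The success probability of the explorer -/

section Success

open scoped ENNReal

/-- The transcript `tr` reveals the edges of the subgraph `s`, and the vertices of `s` are among the
`m` most recently revealed ones, so that an index below `m` addresses any of them. -/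
def Reveals {n : ℕ} {G : SimpleGraph (Fin n)} (tr : List Entry) (m : ℕ) (s : G.Subgraph) : Prop :=
  (∀ v ∈ s.verts, (v : ℕ) ∈ (revealedVertices n tr).take m) ∧ s.spanningCoe ≤ revealedGraph n tr

variable {n : ℕ} {G : SimpleGraph (Fin n)} {tr : List Entry} {m : ℕ} {s s' : G.Subgraph}

lemma reveals_bot (tr : List Entry) (m : ℕ) : Reveals tr m (⊥ : G.Subgraph) := by
  simp [Reveals]

lemma Reveals.sup (h : Reveals tr m s) (h' : Reveals tr m s') : Reveals tr m (s ⊔ s') :=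
  ⟨fun v hv => hv.elim (h.1 v) (h'.1 v), fun _ _ hvu => hvu.elim (h.2 ·) (h'.2 ·)⟩

lemma reveals_singletonSubgraph {u : Fin n} (hu : (u : ℕ) ∈ (revealedVertices n tr).take m) :
    Reveals tr m (G.singletonSubgraph u) := by
  refine ⟨fun v hv => ?_, fun v u hvu => hvu.elim⟩
  rwa [show v = u from hv]

lemma reveals_subgraphOfAdj {v u : Fin n} (h : G.Adj v u)
    (hv : (v : ℕ) ∈ (revealedVertices n tr).take m) (hu : (u : ℕ) ∈ (revealedVertices n tr).take m)
    (hvu : ((v : ℕ), (u : ℕ)) ∈ revealedEdges tr) : Reveals tr m (G.subgraphOfAdj h) := by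
  have hadj : (revealedGraph n tr).Adj v u := revealedGraph_adj.2 ⟨h.ne, Or.inl hvu⟩
  constructor
  · rintro z (rfl | rfl)
    exacts [hv, hu]
  · rintro x y (hxy : s(v, u) = s(x, y))
    rwa [← SimpleGraph.mem_edgeSet, ← hxy]

lemma Reveals.cons (h : Reveals tr m s) (e : Entry) : Reveals (e :: tr) (m + 1) s := by
  refine ⟨fun v hv => ?_, h.2.trans (revealedGraph_le_cons e tr)⟩
  rw [revealedVertices, List.filterMap_cons]
  cases entryVertex n e with
  | none => exact List.take_subset_take_left _ m.le_succ (h.1 v hv)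
  | some u => exact List.mem_cons_of_mem u (h.1 v hv)

lemma Reveals.vertex (h : Reveals tr m s) {u : Fin n} {c : ℕ} (hu : (u : ℕ) = c % n)
    (q : ℕ × Option ℕ) :
    Reveals (Sum.inl q :: Sum.inr c :: tr) (m + 2) (s ⊔ G.singletonSubgraph u) := by
  refine ((h.cons _).cons _).sup (reveals_singletonSubgraph ?_)
  rcases q with ⟨v, _ | a⟩ <;>
    simp [revealedVertices, List.filterMap_cons, entryVertex, hu]

lemma Reveals.neighbor (h : Reveals tr m s) {v u : Fin n} (hv : v ∈ s.verts) (hvu : G.Adj v u)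
    (c : ℕ) :
    Reveals (Sum.inl ((v : ℕ), some (u : ℕ)) :: Sum.inr c :: tr) (m + 2)
      (s ⊔ G.subgraphOfAdj hvu) := by
  have hs := (h.cons (Sum.inr c)).cons (Sum.inl ((v : ℕ), some (u : ℕ)))
  refine hs.sup (reveals_subgraphOfAdj hvu (hs.1 v hv) ?_ ?_)
  · simp [revealedVertices, entryVertex]
  · simp [revealedEdges, entryEdge]

lemma queryVertex_of_div_eq {c i : ℕ} (hc : c / n = i + 1)
    (hi : i < (revealedVertices n tr).length) :
    queryVertex n c tr = (revealedVertices n tr)[i] := by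
  have hcons : revealedVertices n (Sum.inr c :: tr) = c % n :: revealedVertices n tr := rfl
  rw [queryVertex, hcons, hc, List.getD_cons_succ, List.getD_eq_getElem]

variable {κ w : ℕ}

lemma draw_add_one (hn : 0 < n) (hw : 0 < w) : n * w - 1 + 1 = w * n := by
  rw [Nat.sub_add_cancel (Nat.mul_pos hn hw), mul_comm]

lemma inv_le_exploreRound_vertex (hn : 0 < n) (hw : 0 < w) (hs : Reveals tr m s)
    {S : Finset (Fin n)} (hS : n ≤ κ * S.card) :
    (κ : ℝ≥0∞)⁻¹ ≤ (exploreRound w G tr).toOuterMeasure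
      {tr' | ∃ u ∈ S, Reveals tr' (m + 2) (s ⊔ G.singletonSubgraph u)} := by
  refine (inv_le_toOuterMeasure_mod (draw_add_one hn hw) hS).trans
    ((mul_one _).ge.trans (mul_le_toOuterMeasure_bind ?_))
  rintro c ⟨u, hu, huc⟩
  rw [(PMF.toOuterMeasure_apply_eq_one_iff _ _).2]
  intro tr' htr'
  obtain ⟨a, -, rfl⟩ := (PMF.mem_support_map_iff _ _ _).1 htr'
  exact ⟨u, hu, hs.vertex huc _⟩

open Classical in
lemma inv_le_exploreRound_neighbor (hw : m < w) (hs : Reveals tr m s) {v : Fin n}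
    (hv : v ∈ s.verts) {S : Finset (Fin n)} (hSv : S ⊆ G.neighborFinset v) (hne : S.Nonempty)
    (hS : G.degree v ≤ κ * S.card) :
    ((κ * w : ℕ) : ℝ≥0∞)⁻¹ ≤ (exploreRound w G tr).toOuterMeasure
      {tr' | ∃ u ∈ S, ∃ h : G.Adj v u, Reveals tr' (m + 2) (s ⊔ G.subgraphOfAdj h)} := by
  obtain ⟨i, hi, hiv⟩ := List.mem_take_iff_getElem.1 (hs.1 v hv)
  have hwn := draw_add_one v.pos (Nat.zero_lt_of_lt hw)
  rw [Nat.cast_mul, mul_comm, ENNReal.mul_inv (by simp) (by simp)]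
  refine (mul_le_mul_left (inv_le_toOuterMeasure_div hwn (i := i + 1) (by omega)) _).trans
    (mul_le_toOuterMeasure_bind fun c (hc : (c : ℕ) / n = i + 1) => ?_)
  rw [queryVertex_of_div_eq hc (by omega), hiv, oracleAnswer_eq (hne.mono hSv),
    PMF.toOuterMeasure_map_apply, PMF.toOuterMeasure_map_apply]
  refine inv_le_toOuterMeasure_uniformOfFinset _ hSv (fun u hu => ?_) hS
  have hvu : G.Adj v u := by simpa using hSv hu
  exact ⟨u, hu, hvu, hs.neighbor hv hvu c⟩

lemma support_exploreRound_subset {P : SimpleGraph (Fin n) → Prop} (hP : Monotone P)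
    (htr : P (revealedGraph n tr)) :
    (exploreRound w G tr).support ⊆ {tr' | P (revealedGraph n tr')} := by
  intro tr' htr'
  obtain ⟨c, -, htr'⟩ := (PMF.mem_support_bind_iff _ _ _).1 htr'
  obtain ⟨a, -, rfl⟩ := (PMF.mem_support_map_iff _ _ _).1 htr'
  exact hP ((revealedGraph_le_cons _ _).trans (revealedGraph_le_cons _ _)) htr

theorem CanReach.inv_pow_le_toOuterMeasure_chain {P : SimpleGraph (Fin n) → Prop} {j : ℕ}
    (h : CanReach G κ (fun s => P s.spanningCoe) j s) (hP : Monotone P) (hn : 0 < n)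
    (hκw : 0 < κ * w) (hs : Reveals tr m s) (hm : m + 2 * j ≤ w) :
    ((κ * w : ℕ) : ℝ≥0∞)⁻¹ ^ j ≤
      (chain (exploreRound w G) j tr).toOuterMeasure {tr | P (revealedGraph n tr)} := by
  induction h generalizing tr m with
  | done hgoal =>
    have hgood := support_chain_subset (s := {tr | P (revealedGraph n tr)})
      (fun _ => support_exploreRound_subset (G := G) (w := w) hP) (hP hs.2 hgoal)
    rw [(PMF.toOuterMeasure_apply_eq_one_iff _ _).2 (hgood _)]
    exact pow_le_one₀ zero_le (ENNReal.inv_le_one.2 (by exact_mod_cast hκw))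
  | @vertex j s S hS _ ih =>
    have hround : ((κ * w : ℕ) : ℝ≥0∞)⁻¹ ≤ (exploreRound w G tr).toOuterMeasure
        {tr' | ∃ u ∈ S, Reveals tr' (m + 2) (s ⊔ G.singletonSubgraph u)} := by
      refine inv_le_exploreRound_vertex hn (Nat.pos_of_mul_pos_left hκw) hs ?_
      calc n = Fintype.card (Fin n) := (Fintype.card_fin n).symm
        _ ≤ κ * S.card := hS
        _ ≤ κ * w * S.card := Nat.mul_le_mul_right _ (Nat.le_mul_of_pos_right κ (by omega))
    rw [chain, pow_succ']
    refine (mul_le_mul_left hround _).trans (mul_le_toOuterMeasure_bind ?_)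
    rintro tr' ⟨u, hu, hs'⟩
    exact ih u hu hs' (by omega)
  | neighbor S hv hSv hne hS _ ih =>
    rw [chain, pow_succ']
    refine (mul_le_mul_left (inv_le_exploreRound_neighbor (by omega) hs hv hSv hne hS) _).trans
      (mul_le_toOuterMeasure_bind ?_)
    rintro tr' ⟨u, hu, hvu, hs'⟩
    exact ih u hvu hu hs' (by omega)

theorem CanReach.two_thirds_le_verdictProb {P : SimpleGraph (Fin n) → Prop} {J : ℕ}
    (h : CanReach G κ (fun s => P s.spanningCoe) J ⊥) (hP : Monotone P) (hn : 0 < n)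
    (hκw : 0 < κ * w) (hw : 2 * J ≤ w) {N : Params → ℕ} {y : ℕ × ℕ}
    (hN : N (n, y) = 2 * (J * (2 * (κ * w) ^ J))) {verdict : Params × List Entry → Bool} {b : Bool}
    (hb : ∀ tr, P (revealedGraph n tr) → verdict ((n, y), tr) = b) :
    2 / 3 ≤ verdictProb (explorer N w verdict) (n, y) G b := by
  have hround (tr : List Entry) : (((κ * w) ^ J : ℕ) : ℝ≥0∞)⁻¹ ≤
      (chain (exploreRound w G) J tr).toOuterMeasure {tr | P (revealedGraph n tr)} := by
    rw [Nat.cast_pow, ENNReal.inv_pow]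
    exact h.inv_pow_le_toOuterMeasure_chain hP hn hκw (reveals_bot tr 0) (by omega)
  calc 2 / 3
    _ ≤ (chain (exploreRound w G) (J * (2 * (κ * w) ^ J)) []).toOuterMeasure
          {tr | P (revealedGraph n tr)} :=
        two_thirds_le_toOuterMeasure_chain (fun _ => support_exploreRound_subset hP)
          (Nat.pow_pos hκw) hround []
    _ = (run (explorer N w verdict) (n, y) G (N (n, y))).toOuterMeasure
          {tr | P (revealedGraph n tr)} := by rw [hN, run_explorer_two_mul hN.ge]
    _ ≤ (run (explorer N w verdict) (n, y) G (N (n, y))).toOuterMeasure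
          {tr | verdict ((n, y), tr) = b} :=
        PMF.toOuterMeasure_mono _ (Set.inter_subset_left.trans hb)
    _ ≤ verdictProb (explorer N w verdict) (n, y) G b := toOuterMeasure_verdict_le b

end Success

/-! ### Computability -/

section Computability

variable {α : Type*} [Primcodable α]

lemma primrecPred_forall_mem {ι : Type*} {s : Set ι} (hs : s.Finite) {P : ι → α → Prop}
    (h : ∀ i ∈ s, PrimrecPred (P i)) : PrimrecPred fun a => ∀ i ∈ s, P i a := by
  classical
  induction s, hs using Set.Finite.induction_on with
  | empty => exact ⟨fun _ => .isTrue (by simp), (Primrec.const true).of_eq fun _ => by simp⟩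
  | @insert i s _ _ ih =>
    refine ((h i (Set.mem_insert i s)).and (ih fun j hj => h j (Set.mem_insert_of_mem i hj))).of_eq
      fun a => ?_
    simp only [Set.forall_mem_insert]

lemma primrecPred_mem_list {β : Type*} [Primcodable β] {f : α → β} {l : α → List β}
    (hf : Primrec f) (hl : Primrec l) : PrimrecPred fun a => f a ∈ l a :=
  ((PrimrecRel.exists_mem_list Primrec.eq).comp hl hf).of_eq fun a => by simp

lemma primrec_pow_const {f : α → ℕ} (hf : Primrec f) (j : ℕ) : Primrec fun a => f a ^ j := by
  induction j with
  | zero => exact (Primrec.const 1).of_eq fun a => (pow_zero _).symm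
  | succ j ih => exact (Primrec.nat_mul.comp ih hf).of_eq fun a => (pow_succ _ _).symm

lemma primrec_entryVertex : Primrec₂ entryVertex :=
  (Primrec.sumCasesOn Primrec.snd (g := fun _ z => z.2) (h := fun y c => some (c % y.1))
    (Primrec.snd.comp Primrec.snd).to₂ (Primrec.option_some.comp (Primrec.nat_mod.comp Primrec.snd
      (Primrec.fst.comp Primrec.fst))).to₂).of_eq fun y => by rcases y with ⟨n, z | c⟩ <;> rfl

lemma primrec_entryEdge : Primrec entryEdge :=
  (Primrec.sumCasesOn Primrec.id (g := fun _ z => z.2.map fun u => (z.1, u)) (h := fun _ _ => none)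
    (Primrec.option_map (Primrec.snd.comp Primrec.snd)
      ((Primrec.fst.comp (Primrec.snd.comp Primrec.fst)).pair Primrec.snd).to₂).to₂
    (Primrec.const none).to₂).of_eq fun e => by rcases e with z | c <;> rfl

lemma primrec_revealedVertices : Primrec₂ revealedVertices :=
  Primrec.listFilterMap Primrec.snd
    (primrec_entryVertex.comp (Primrec.fst.comp Primrec.fst) Primrec.snd)

lemma primrec_revealedEdges : Primrec revealedEdges :=
  Primrec.listFilterMap Primrec.id (primrec_entryEdge.comp Primrec.snd)

lemma primrec_queryVertex :
    Primrec fun z : ℕ × ℕ × List Entry => queryVertex z.1 z.2.1 z.2.2 := by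
  have hc : Primrec fun z : ℕ × ℕ × List Entry => z.2.1 := Primrec.fst.comp Primrec.snd
  exact (Primrec.list_getD 0).comp (primrec_revealedVertices.comp Primrec.fst
    (Primrec.list_cons.comp (Primrec.sumInr.comp hc) (Primrec.snd.comp Primrec.snd)))
    (Primrec.nat_div.comp hc Primrec.fst)

lemma primrec_nextAction (w : ℕ) : Primrec₂ fun n tr => nextAction n w tr := by
  have hdraw : Primrec fun n : ℕ => (Sum.inr (n * w - 1) : ℕ ⊕ ℕ) :=
    Primrec.sumInr.comp (Primrec.pred.comp (Primrec.nat_mul.comp Primrec.id (Primrec.const w)))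
  have hcons : Primrec₂ fun (z : ℕ × List Entry) (y : Entry × List Entry) =>
      (Sum.casesOn y.1 (fun _ => Sum.inr (z.1 * w - 1))
        fun c => Sum.inl (queryVertex z.1 c y.2) : ℕ ⊕ ℕ) := by
    refine Primrec.sumCasesOn (Primrec.fst.comp Primrec.snd) ?_ ?_
    · exact hdraw.comp (Primrec.fst.comp (Primrec.fst.comp Primrec.fst))
    · exact Primrec.sumInl.comp (primrec_queryVertex.comp
        ((Primrec.fst.comp (Primrec.fst.comp Primrec.fst)).pair
          (Primrec.snd.pair (Primrec.snd.comp (Primrec.snd.comp Primrec.fst)))))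
  refine (Primrec.list_casesOn Primrec.snd (hdraw.comp Primrec.fst) hcons).of_eq fun z => ?_
  rcases z with ⟨n, _ | ⟨_ | _, _⟩⟩ <;> rfl

lemma primrec_explorer {N : Params → ℕ} {w : ℕ} {verdict : Params × List Entry → Bool}
    (hN : Primrec N) (hverdict : Primrec verdict) : Primrec (explorer N w verdict) :=
  Primrec.ite (Primrec.nat_le.comp (hN.comp Primrec.fst) (Primrec.list_length.comp Primrec.snd))
    (Primrec.sumInl.comp hverdict)
    (Primrec.sumInr.comp ((primrec_nextAction w).comp (Primrec.fst.comp Primrec.fst) Primrec.snd))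

variable {k : ℕ} {H : SimpleGraph (Fin k)}

/-- The number `c` encodes a copy of `H` among the edges revealed by the transcript `z.2`. A map
`Fin k → Fin n` is encoded by the number below `n ^ k` whose digits in base `n = z.1` are its
values, so that the search for a copy is a bounded one. -/
def EncodesCopy (H : SimpleGraph (Fin k)) (c : ℕ) (z : ℕ × List Entry) : Prop :=
  (∀ e ∈ {e : Fin k × Fin k | e.1 ≠ e.2},
    c / z.1 ^ (e.1 : ℕ) % z.1 ≠ c / z.1 ^ (e.2 : ℕ) % z.1) ∧
  ∀ e ∈ {e : Fin k × Fin k | H.Adj e.1 e.2},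
    (c / z.1 ^ (e.1 : ℕ) % z.1, c / z.1 ^ (e.2 : ℕ) % z.1) ∈ revealedEdges z.2 ∨
      (c / z.1 ^ (e.2 : ℕ) % z.1, c / z.1 ^ (e.1 : ℕ) % z.1) ∈ revealedEdges z.2

lemma isContained_revealedGraph_iff {n : ℕ} {tr : List Entry} :
    H.IsContained (revealedGraph n tr) ↔ ∃ c < n ^ k, EncodesCopy H c (n, tr) := by
  simp only [EncodesCopy, Set.mem_ofPred_eq, Prod.forall]
  constructor
  · rintro ⟨f⟩
    obtain ⟨c, hc⟩ := finFunctionFinEquiv.symm.surjective f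
    have hdigit (i : Fin k) : (c : ℕ) / n ^ (i : ℕ) % n = f i := by
      rw [← hc]
      rfl
    refine ⟨c, c.2, fun i j hij => ?_, fun i j hij => ?_⟩
    · rw [hdigit, hdigit]
      exact fun h => hij (f.injective (Fin.ext h))
    · rw [hdigit, hdigit]
      exact (revealedGraph_adj.1 (f.toHom.map_adj hij)).2
  · rintro ⟨c, hc, hinj, hadj⟩
    refine ⟨⟨⟨finFunctionFinEquiv.symm ⟨c, hc⟩, fun {i j} hij => ?_⟩, fun i j h => ?_⟩⟩
    · exact revealedGraph_adj.2 ⟨fun h => hinj i j hij.ne (congrArg Fin.val h), hadj i j hij⟩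
    · by_contra hij
      exact hinj i j hij (congrArg Fin.val h)

lemma primrecRel_encodesCopy (H : SimpleGraph (Fin k)) : PrimrecRel (EncodesCopy H) := by
  have hdigit (i : Fin k) :
      Primrec fun y : ℕ × ℕ × List Entry => y.1 / y.2.1 ^ (i : ℕ) % y.2.1 :=
    have hn := Primrec.fst.comp Primrec.snd
    Primrec.nat_mod.comp (Primrec.nat_div.comp Primrec.fst (primrec_pow_const hn _)) hn
  have hedges := primrec_revealedEdges.comp (Primrec.snd.comp (Primrec.snd (α := ℕ) (β := ℕ × _)))
  exact (primrecPred_forall_mem (Set.toFinite {e : Fin k × Fin k | e.1 ≠ e.2})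
    fun e _ => (Primrec.eq.comp (hdigit e.1) (hdigit e.2)).not).and <|
      primrecPred_forall_mem (Set.toFinite {e : Fin k × Fin k | H.Adj e.1 e.2})
        fun e _ => (primrecPred_mem_list ((hdigit e.1).pair (hdigit e.2)) hedges).or
          (primrecPred_mem_list ((hdigit e.2).pair (hdigit e.1)) hedges)

lemma primrecPred_isContained_revealedGraph (H : SimpleGraph (Fin k)) :
    PrimrecPred fun z : ℕ × List Entry => H.IsContained (revealedGraph z.1 z.2) :=
  ((primrecRel_encodesCopy H).exists_mem_list.comp
    (Primrec.list_range.comp (primrec_pow_const Primrec.fst k)) Primrec.id).of_eq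
    fun z => by simp [isContained_revealedGraph_iff]

end Computability

/-! ### The tester -/

section Tester

/-- The number of lucky guesses that reveal a copy of a graph with `k` vertices. -/
def guesses (k : ℕ) : ℕ := k * (budget k k + 1)

/-- The number of steps that reveal a copy of a graph with `k` vertices with probability at least
`2 / 3` in a graph with `r`-admissibility at most `p` from which at least `n / d` edges have to be
deleted to remove all the copies. -/
def stepBound (k r p d : ℕ) : ℕ :=
  2 * (guesses k * (2 * (densityConst k r p d * (2 * guesses k + 1)) ^ guesses k))

open Classical in
/-- The tester for `H`-freeness of graphs with `r`-admissibility at most `p`: explore the graph for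
a bounded number of steps and reject if the revealed subgraph contains a copy of `H`. -/
noncomputable def hTester {k : ℕ} (H : SimpleGraph (Fin k)) (r p : ℕ) : OracleAlgorithm :=
  explorer (fun x => stepBound k r p (x.2.2 / x.2.1 + 1)) (2 * guesses k + 1)
    fun z => !decide (H.IsContained (revealedGraph z.1.1 z.2))

variable {k n r p a b : ℕ} {H : SimpleGraph (Fin k)} {G : SimpleGraph (Fin n)}

lemma computable_hTester (H : SimpleGraph (Fin k)) (r p : ℕ) : Computable (hTester H r p) := by
  classical
  have hdensity : Primrec fun x : Params => densityConst k r p (x.2.2 / x.2.1 + 1) :=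
    have hd : Primrec fun x : Params => x.2.2 / x.2.1 + 1 :=
      Primrec.succ.comp (Primrec.nat_div.comp (Primrec.snd.comp Primrec.snd)
        (Primrec.fst.comp Primrec.snd))
    have hmul (c : ℕ) {f : Params → ℕ} (hf : Primrec f) : Primrec fun x => f x * c :=
      Primrec.nat_mul.comp hf (Primrec.const c)
    Primrec.succ.comp (hmul _ (hmul _ (hmul _ hd)))
  have hsteps : Primrec fun x : Params => stepBound k r p (x.2.2 / x.2.1 + 1) :=
    have hmul (c : ℕ) {f : Params → ℕ} (hf : Primrec f) : Primrec fun x => c * f x :=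
      Primrec.nat_mul.comp (Primrec.const c) hf
    hmul 2 (hmul _ (hmul 2 (primrec_pow_const
      (Primrec.nat_mul.comp hdensity (Primrec.const _)) _)))
  exact (primrec_explorer hsteps (Primrec.not.comp ((primrecPred_isContained_revealedGraph H).comp
    ((Primrec.fst.comp Primrec.fst).pair Primrec.snd)).decide)).to_comp

lemma verdictProb_hTester_of_free (hG : H.Free G) :
    verdictProb (hTester H r p) (n, a, b) G true = 1 := by
  refine le_antisymm (verdictProb_le_one true) (le_trans ?_ (toOuterMeasure_verdict_le true))
  refine ((PMF.toOuterMeasure_apply_eq_one_iff _ _).2 fun tr htr => ?_).ge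
  have hfree : ¬ H.IsContained (revealedGraph n tr) := fun hH =>
    hG (hH.mono_right (revealedGraph_le_of_mem_support_run htr))
  simpa using hfree

lemma card_le_mul_ncard_symmDiff_of_isFar {P : GraphFamily} (ha : 0 < a) (hb : 0 < b)
    (h : IsFar P ((a : ℝ) / b) G) {G' : SimpleGraph (Fin n)} (hG' : G' ∈ P n) :
    n ≤ (b / a + 1) * (symmDiff G.edgeSet G'.edgeSet).ncard := by
  have hfar : a * n ≤ (symmDiff G.edgeSet G'.edgeSet).ncard * b := by
    have := h G' hG'
    rw [div_mul_eq_mul_div, div_le_iff₀ (by positivity)] at this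
    exact_mod_cast this
  refine Nat.le_of_mul_le_mul_left (hfar.trans ?_) ha
  calc _ ≤ _ * (a * (b / a + 1)) := Nat.mul_le_mul_left _ (Nat.lt_mul_div_succ b ha).le
    _ = _ := by ring

lemma card_le_mul_card_of_isFar_of_free_deleteEdges (ha : 0 < a) (hb : 0 < b)
    (h : IsFar (HFreeness H) ((a : ℝ) / b) G) {X : Finset (Sym2 (Fin n))}
    (hX : H.Free (G.deleteEdges X)) : n ≤ (b / a + 1) * X.card := by
  have hsub : symmDiff G.edgeSet (G.deleteEdges X).edgeSet ⊆ X := by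
    simp [SimpleGraph.edgeSet_deleteEdges, symmDiff_def, Set.subset_def]
  calc n ≤ (b / a + 1) * _ := card_le_mul_ncard_symmDiff_of_isFar ha hb h hX
    _ ≤ (b / a + 1) * X.card := by
      gcongr
      simpa only [Set.ncard_coe_finset] using Set.ncard_le_ncard hsub X.finite_toSet

lemma two_thirds_le_verdictProb_hTester_of_isFar (hn : 0 < n) (ha : 0 < a) (hb : 0 < b)
    (hkr : k ≤ r) (hG : adm G r ≤ p) (h : IsFar (HFreeness H) ((a : ℝ) / b) G) :
    2 / 3 ≤ verdictProb (hTester H r p) (n, a, b) G false := by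
  have : Nonempty (Fin n) := ⟨⟨0, hn⟩⟩
  have hreach := canReach_isContained_of_far hG (by simpa using hkr) (d := b / a + 1) (H := H)
    fun X hX => by simpa using card_le_mul_card_of_isFar_of_free_deleteEdges ha hb h hX
  simp only [Fintype.card_fin] at hreach
  exact hreach.two_thirds_le_verdictProb (P := H.IsContained)
    (fun _ _ hle hH => hH.mono_right hle) hn (Nat.mul_pos (Nat.succ_pos _) (Nat.succ_pos _))
    (Nat.le_succ _) rfl fun tr htr => by simpa using htr

end Tester

end GraphTesting

theorem theorem1_general {k r p : ℕ} (H : SimpleGraph (Fin k)) (F : GraphTesting.GraphFamily)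
    (hkr : k ≤ r) (hF : ∀ n, ∀ G ∈ F n, GraphTesting.adm G r ≤ p) :
    GraphTesting.TestableOneSided (GraphTesting.HFreeness H) F := by
  refine ⟨GraphTesting.hTester H r p, fun ε => GraphTesting.stepBound k r p (⌊ε⁻¹⌋₊ + 1),
    GraphTesting.computable_hTester H r p, fun n a b hn ha hb G hG =>
      ⟨GraphTesting.halts_explorer, ?_, GraphTesting.verdictProb_hTester_of_free,
        GraphTesting.two_thirds_le_verdictProb_hTester_of_isFar hn ha hb hkr (hF n G hG)⟩⟩
  simp only [inv_div, Nat.floor_div_eq_div]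
  exact GraphTesting.queriesAtMost_explorer

theorem theorem1 (F : GraphTesting.GraphFamily) (hF : GraphTesting.UniversallyBoundedAdm F) :
    GraphTesting.HTestable F := by
  intro k H
  obtain ⟨f, -, hf⟩ := hF
  exact theorem1_general H F k.le_succ (hf (k + 1) k.succ_pos)
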